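/- Let $n\ge 2$, $p\ge 2$, let $\Omega\subseteq\mathbb R^n$ be open, and put $H_{p-1}(\xi)=(|\xi|-1)_+^{p-1}\,\xi/|\xi|$ for $\xi\neq 0$, $H_{p-1}(0)=0$. Write $U\Subset\Omega$ if $\overline U$ is compact and contained in $\Omega$. Let $f:\Omega\times\mathbb R\to\mathbb R$ be such that (i) $f(x,s)>0$ for all $x\in\Omega$, $s\in\mathbb R$; (ii) for every open $U\Subset\Omega$ and every $K>0$ there are constants $L,M>0$ with $|f(x,s)-f(x,t)|\le L|s-t|$ and $|f(x,s)-f(y,s)|\le M|x-y|$ for all $x,y\in U$ and $|s|,|t|\le K$; (iii) for every $x\in\Omega$ the function $s\mapsto f(x,s)$ is non-increasing. Let $u,v\in W^{1,\infty}_{loc}(\Omega)$ (identified with their continuous representatives, $Du$, $Dv$ denoting the weak gradients) be local weak solutions of $$-\operatorname{div}\Big((|Du|-1)_+^{p-1}\frac{Du}{|Du|}\Big)=f(x,u)\quad\text{in }\Omega,$$ that is, for every open $U\Subset\Omega$ and every $\varphi\in W^{1,p}_0(U)$, $$\int_\Omega\langle H_{p-1}(Du),D\varphi\rangle\,dx=\int_\Omega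 f(x,u)\,\varphi\,dx,$$ where $\varphi$ is extended by zero outside $U$, and likewise for $v$. Then: (a) If $\Omega'\Subset\Omega$ is open and $u\le v$ on $\partial\Omega'$, then $u\le v$ in $\Omega'$. (b) If $\{x\in\Omega:|Du(x)|\le 1\}\Subset\Omega$ for some representative of $Du$, and $u\le v$ on $\partial\Omega$ in the sense that $\limsup_{x\to y,\,x\in\Omega}(u(x)-v(x))\le 0$ for every $y\in\partial\Omega$ and, in case $\Omega$ is unbounded, also $\limsup_{|x|\to\infty,\,x\in\Omega}(u(x)-v(x))\le 0$, then $u\le v$ in $\Omega$. -/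

import Mathlib

open MeasureTheory Filter Topology
open scoped ContDiff ENNReal

namespace WeakComparison

/-- Euclidean space `ℝⁿ`. -/
abbrev E (n : ℕ) : Type := EuclideanSpace ℝ (Fin n)

variable {n : ℕ}

/-- `U ⋐ Ω`: the closure of `U` is compact and contained in `Ω`. -/
def CompactlyContained (U Ω : Set (E n)) : Prop :=
  IsCompact (closure U) ∧ closure U ⊆ Ω

/-- The vector field `H_γ(ξ) = (|ξ| - 1)₊^γ ξ / |ξ|` for `ξ ≠ 0`, and `H_γ(0) = 0`. -/
noncomputable def H (γ : ℝ) (ξ : E n) : E n :=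
  open Classical in
  if ξ = 0 then 0 else ((max (‖ξ‖ - 1) 0) ^ γ * ‖ξ‖⁻¹) • ξ

/-- `φ ∈ C_c^∞(U)`. -/
def IsTestFunction (U : Set (E n)) (φ : E n → ℝ) : Prop :=
  ContDiff ℝ ∞ φ ∧ HasCompactSupport φ ∧ tsupport φ ⊆ U

/-- `G` is (a representative of) the weak gradient of `u` in the open set `U`. -/
def HasWeakGradient (U : Set (E n)) (u : E n → ℝ) (G : E n → E n) : Prop :=
  LocallyIntegrableOn u U volume ∧ LocallyIntegrableOn G U volume ∧
    ∀ φ : E n → ℝ, IsTestFunction U φ →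
      ∫ x in U, u x • gradient φ x = - ∫ x in U, φ x • G x

/-- `u ∈ W^{1,q}(U)` with weak gradient `G`. -/
def MemW1 (q : ℝ≥0∞) (U : Set (E n)) (u : E n → ℝ) (G : E n → E n) : Prop :=
  HasWeakGradient U u G ∧ MemLp u q (volume.restrict U) ∧ MemLp G q (volume.restrict U)

/-- `u ∈ W^{1,q}_loc(Ω)` with weak gradient `G`. -/
def MemW1Loc (q : ℝ≥0∞) (Ω : Set (E n)) (u : E n → ℝ) (G : E n → E n) : Prop :=
  HasWeakGradient Ω u G ∧
    ∀ U : Set (E n), IsOpen U → CompactlyContained U Ω → MemW1 q U u G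

/-- `φ ∈ W^{1,q}_0(U)` with weak gradient `G`: `φ` belongs to the closure of `C_c^∞(U)` in
`W^{1,q}(U)`. -/
def MemW1Zero (q : ℝ≥0∞) (U : Set (E n)) (φ : E n → ℝ) (G : E n → E n) : Prop :=
  MemW1 q U φ G ∧
    ∃ φs : ℕ → E n → ℝ, (∀ k, IsTestFunction U (φs k)) ∧
      Tendsto (fun k => eLpNorm (fun x => φs k x - φ x) q (volume.restrict U)) atTop (𝓝 0) ∧
      Tendsto (fun k => eLpNorm (fun x => gradient (φs k) x - G x) q (volume.restrict U))
        atTop (𝓝 0)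

/-- `u ∈ W^{1,p}_loc(Ω)`, with weak gradient `Du`, is a local weak solution of
`-div H_{p-1}(Du) = f(x,u)` in `Ω`. A test function of `W^{1,p}_0(U)` is zero outside `U`, so both
integrals are over `U`; that they exist is part of the definition (and automatic when `u` is
locally Lipschitz and `f` is continuous). -/
def IsLocalWeakSolution (p : ℝ) (f : E n → ℝ → ℝ) (Ω : Set (E n))
    (u : E n → ℝ) (Du : E n → E n) : Prop :=
  MemW1Loc (ENNReal.ofReal p) Ω u Du ∧
    ∀ U : Set (E n), IsOpen U → CompactlyContained U Ω →
      ∀ (φ : E n → ℝ) (Dφ : E n → E n), MemW1Zero (ENNReal.ofReal p) U φ Dφ →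
        IntegrableOn (fun x => inner ℝ (H (p - 1) (Du x)) (Dφ x)) U volume ∧
        IntegrableOn (fun x => f x (u x) * φ x) U volume ∧
        ∫ x in U, inner ℝ (H (p - 1) (Du x)) (Dφ x) = ∫ x in U, f x (u x) * φ x

/-- The local Lipschitz conditions on the right-hand side, in `s` and in `x`. -/
def LocallyLipschitzRHS (Ω : Set (E n)) (f : E n → ℝ → ℝ) : Prop :=
  ∀ U : Set (E n), IsOpen U → CompactlyContained U Ω → ∀ K : ℝ, 0 < K →
    ∃ L M : ℝ, 0 < L ∧ 0 < M ∧
      (∀ x ∈ U, ∀ s t : ℝ, |s| ≤ K → |t| ≤ K → |f x s - f x t| ≤ L * |s - t|) ∧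
      (∀ x ∈ U, ∀ y ∈ U, ∀ s : ℝ, |s| ≤ K → |f x s - f y s| ≤ M * ‖x - y‖)

/-- `u ≤ v` on `∂Ω` for functions that are only given inside `Ω`: `limsup (u - v) ≤ 0` at every
boundary point and, if `Ω` is unbounded, also at infinity. For bounded `Ω` the second condition
is void. -/
def LeOnBoundary (Ω : Set (E n)) (u v : E n → ℝ) : Prop :=
  (∀ y ∈ frontier Ω, ∀ ε : ℝ, 0 < ε → ∀ᶠ x in 𝓝[Ω] y, u x ≤ v x + ε) ∧
    ∀ ε : ℝ, 0 < ε → ∀ᶠ x in Bornology.cobounded (E n) ⊓ 𝓟 Ω, u x ≤ v x + ε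

end WeakComparison

/-! The operator is degenerate: `H` vanishes on the whole unit ball, so monotonicity alone yields
only H(Du) = H(Dv) where u > v + ε, and the gradients could still differ inside the ball. Positivity
of f excludes this: wherever the right-hand side is positive, H(Du) ≠ 0 almost everywhere
(`WeakEquation.ae_H_ne_zero`). Since `H` is injective off its zero set (`eq_of_H_eq`), Du = Dv a.e.
there. Hence the truncation (u - v - ε)₊ has zero gradient and, being compactly supported, vanishes.

The nonvanishing of V = H(Du) comes from two competing estimates. Cocoercivity (`H_cocoercive`) and
the difference-quotient method bound V(x + h) - V(x) in L² by a multiple of |h|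
(`WeakEquation.difference_quotient`). Testing with a cone of radius r shows that the integral of |V|
over a ball B_r(z) is at least of order r|B_r| (`WeakEquation.le_integral_norm`). If V vanished on a
compact set A of positive measure, averaging the lower bound over z ∈ A would make the integral of
|V(· + y)| over A of order r for suitable |y| ≤ r. The L² bound makes it o(r), because V(x + y) ≠ 0
with x ∈ A forces x + y into the r-shell around A, whose measure tends to 0.

Both parts of the theorem reduce to `le_add_of_isCompact`, where the boundary condition enters only
through compactness of {u - v ≥ ε}. -/

namespace WeakComparison

variable {n : ℕ}

/-! ### The field `H`: Lipschitz modulus, zero set, injectivity, cocoercivity -/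

/-- The modulus `t ↦ (t - 1)₊^γ` of the field `H`. -/
noncomputable def profile (γ t : ℝ) : ℝ := (max (t - 1) 0) ^ γ

lemma profile_nonneg (γ t : ℝ) : 0 ≤ profile γ t :=
  Real.rpow_nonneg (le_max_right _ _) _

lemma profile_mono {γ : ℝ} (hγ : 0 ≤ γ) : Monotone (profile γ) := fun s t h =>
  Real.rpow_le_rpow (le_max_right _ _) (max_le_max (by linarith) le_rfl) hγ

lemma profile_of_le_one {γ t : ℝ} (hγ : 0 < γ) (ht : t ≤ 1) : profile γ t = 0 := by
  rw [profile, max_eq_right (by linarith), Real.zero_rpow hγ.ne']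

lemma profile_pos {γ t : ℝ} (ht : 1 < t) : 0 < profile γ t :=
  Real.rpow_pos_of_pos (lt_max_of_lt_left (by linarith)) _

/-- Convexity of the power: its graph lies above the tangent at t. After division by t ^ γ this is
Bernoulli's inequality at s / t - 1. -/
lemma rpow_sub_rpow_le {γ s t : ℝ} (hγ : 1 ≤ γ) (hs : 0 ≤ s) (hst : s ≤ t) :
    t ^ γ - s ^ γ ≤ γ * t ^ (γ - 1) * (t - s) := by
  rcases (hs.trans hst).eq_or_lt with h | h
  · have : s = 0 := le_antisymm (h ▸ hst) hs
    simp [← h, this]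
  · have h1 := one_add_mul_self_le_rpow_one_add (s := s / t - 1)
      (by linarith [div_nonneg hs h.le]) hγ
    rw [add_sub_cancel, Real.div_rpow hs h.le, le_div_iff₀ (Real.rpow_pos_of_pos h γ)] at h1
    rw [Real.rpow_sub_one h.ne']
    have h2 : (1 + γ * (s / t - 1)) * t ^ γ = t ^ γ - γ * (t ^ γ / t) * (t - s) := by
      field_simp
      ring
    linarith

lemma profile_sub_le {γ R s t : ℝ} (hγ : 1 ≤ γ) (hst : s ≤ t) (ht : t ≤ R) :
    profile γ t - profile γ s ≤ γ * (max (R - 1) 0) ^ (γ - 1) * (t - s) := by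
  have h := rpow_sub_rpow_le hγ (le_max_right (s - 1) 0)
    (max_le_max (sub_le_sub_right hst 1) le_rfl)
  refine h.trans ?_
  have h1 : max (t - 1) 0 - max (s - 1) 0 ≤ t - s := by
    rcases max_cases (t - 1) 0 with h | h <;> rcases max_cases (s - 1) 0 with h' | h' <;> linarith
  have h2 : (max (t - 1) 0) ^ (γ - 1) ≤ (max (R - 1) 0) ^ (γ - 1) :=
    Real.rpow_le_rpow (le_max_right _ _) (max_le_max (by linarith) le_rfl) (by linarith)
  have h3 : 0 ≤ (max (t - 1) 0) ^ (γ - 1) := Real.rpow_nonneg (le_max_right _ _) _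
  have h4 : 0 ≤ t - s := sub_nonneg.2 hst
  have h5 : 0 ≤ γ := by linarith
  calc _ ≤ γ * (max (t - 1) 0) ^ (γ - 1) * (t - s) := by gcongr
    _ ≤ _ := by gcongr

lemma H_eq (γ : ℝ) (ξ : E n) : H γ ξ = profile γ ‖ξ‖ • (‖ξ‖⁻¹ • ξ) := by
  by_cases h : ξ = 0
  · simp [H, h]
  · simp [H, h, profile, smul_smul]

lemma norm_H {γ : ℝ} (hγ : 0 < γ) (ξ : E n) : ‖H γ ξ‖ = profile γ ‖ξ‖ := by
  by_cases h : ξ = 0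
  · simp [H, h, profile_of_le_one hγ]
  · rw [H_eq, norm_smul, norm_smul, norm_inv, norm_norm,
      inv_mul_cancel₀ (norm_ne_zero_iff.2 h), mul_one, Real.norm_of_nonneg (profile_nonneg _ _)]

lemma H_eq_zero_iff {γ : ℝ} (hγ : 0 < γ) (ξ : E n) : H γ ξ = 0 ↔ ‖ξ‖ ≤ 1 := by
  rw [← norm_eq_zero, norm_H hγ]
  refine ⟨fun h => ?_, profile_of_le_one hγ⟩
  by_contra h'
  exact (profile_pos (not_le.1 h')).ne' h

/-- Off the unit ball the modulus is strictly increasing, so the length of the value determines ‖ξ‖,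
and then its direction determines ξ. -/
lemma eq_of_H_eq {γ : ℝ} (hγ : 0 < γ) {ξ ζ : E n} (h : H γ ξ = H γ ζ) (h0 : H γ ξ ≠ 0) :
    ξ = ζ := by
  have h1 : 1 < ‖ξ‖ := not_le.1 fun h' => h0 ((H_eq_zero_iff hγ ξ).2 h')
  have h2 : 1 < ‖ζ‖ := not_le.1 fun h' => h0 (h ▸ (H_eq_zero_iff hγ ζ).2 h')
  have h3 : profile γ ‖ξ‖ = profile γ ‖ζ‖ := by rw [← norm_H hγ, ← norm_H hγ, h]
  have h4 : ‖ξ‖ = ‖ζ‖ := by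
    have := (Real.rpow_left_inj (le_max_right _ _) (le_max_right _ _) hγ.ne').1 h3
    rw [max_eq_left (by linarith), max_eq_left (by linarith)] at this
    linarith
  rw [H_eq, H_eq, h3, h4] at h
  have h5 := smul_right_injective (E n) (profile_pos (γ := γ) h2).ne' h
  exact smul_right_injective (E n) (inv_ne_zero (by linarith : ‖ζ‖ ≠ 0)) h5

/-- On bounded sets the gradient `H` of a convex function is cocoercive. -/
lemma H_cocoercive {γ : ℝ} (hγ : 1 ≤ γ) (R : ℝ) :
    ∃ C : ℝ, 0 < C ∧ ∀ ξ ζ : E n, ‖ξ‖ ≤ R → ‖ζ‖ ≤ R →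
      ‖H γ ξ - H γ ζ‖ ^ 2 ≤ C * inner ℝ (H γ ξ - H γ ζ) (ξ - ζ) := by
  -- A Lipschitz constant of `profile γ` on (-∞, R], finite because γ ≥ 1; the added 1 keeps C
  -- positive when that constant is 0.
  set C := γ * (max (R - 1) 0) ^ (γ - 1) + 1 with hC
  have hC1 : 1 ≤ C := by
    have : 0 ≤ (max (R - 1) 0) ^ (γ - 1) := Real.rpow_nonneg (le_max_right _ _) _
    nlinarith
  have hprof : ∀ s t, s ≤ t → t ≤ R → profile γ t - profile γ s ≤ C * (t - s) := fun s t h h' =>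
    (profile_sub_le hγ h h').trans (by nlinarith)
  refine ⟨C, by linarith, fun ξ ζ hξ hζ => ?_⟩
  have hγ0 : 0 < γ := by linarith
  -- Polar form with e = 0 at the origin, so a * ‖e‖ ^ 2 = a replaces ‖e‖ = 1 and no case
  -- distinction on ξ, ζ is needed later.
  have key : ∀ ξ : E n, ‖ξ‖ ≤ R → ∃ e : E n, ∃ a r : ℝ, H γ ξ = a • e ∧ ξ = r • e ∧ ‖e‖ ≤ 1 ∧
      a * ‖e‖ ^ 2 = a ∧ r * ‖e‖ ^ 2 = r ∧ r = ‖ξ‖ ∧ a = profile γ r ∧ a ≤ C * r := by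
    intro ξ hξ
    have ha : profile γ ‖ξ‖ ≤ C * ‖ξ‖ := by
      have := hprof 0 ‖ξ‖ (norm_nonneg _) hξ
      rw [profile_of_le_one hγ0 zero_le_one] at this
      linarith
    by_cases h : ξ = 0
    · refine ⟨0, 0, 0, ?_⟩
      simp [H, h, profile_of_le_one hγ0]
    · have h' : ‖ξ‖ ≠ 0 := norm_ne_zero_iff.2 h
      have he : ‖‖ξ‖⁻¹ • ξ‖ = 1 := by
        rw [norm_smul, norm_inv, norm_norm, inv_mul_cancel₀ h']
      refine ⟨‖ξ‖⁻¹ • ξ, profile γ ‖ξ‖, ‖ξ‖, H_eq _ _, ?_, he.le, by simp [he], by simp [he], rfl,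
        rfl, ha⟩
      rw [smul_smul, mul_inv_cancel₀ h', one_smul]
  obtain ⟨e, a, r, h1, h2, h3, h4, h5, h6, h7, h8⟩ := key ξ hξ
  obtain ⟨e', b, s, k1, k2, k3, k4, k5, k6, k7, k8⟩ := key ζ hζ
  have hc : inner ℝ e e' ≤ 1 := (real_inner_le_norm e e').trans
    (mul_le_one₀ h3 (norm_nonneg _) k3)
  have ha0 : 0 ≤ a := h7 ▸ profile_nonneg _ _
  have hb0 : 0 ≤ b := k7 ▸ profile_nonneg _ _
  have hr0 : 0 ≤ r := h6 ▸ norm_nonneg _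
  have hs0 : 0 ≤ s := k6 ▸ norm_nonneg _
  rw [← h6] at hξ
  rw [← k6] at hζ
  have hmon : (a - b) ^ 2 ≤ C * ((a - b) * (r - s)) := by
    rcases le_total s r with h | h
    · have h9 := hprof s r h hξ
      have h10 := profile_mono hγ0.le h
      rw [← h7, ← k7] at h9 h10
      nlinarith
    · have h9 := hprof r s h hζ
      have h10 := profile_mono hγ0.le h
      rw [← h7, ← k7] at h9 h10
      nlinarith
  -- Both sides split into a radial term and a nonnegative multiple of 1 - ⟨e, e'⟩. The radial terms
  -- compare by `hmon`, the angular ones by a ≤ C * r and b ≤ C * s.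
  have hlhs : ‖H γ ξ - H γ ζ‖ ^ 2 = (a - b) ^ 2 + 2 * (a * b) * (1 - inner ℝ e e') := by
    rw [h1, k1, norm_sub_sq_real, norm_smul, norm_smul, mul_pow, mul_pow, inner_smul_left,
      inner_smul_right]
    simp only [Real.norm_eq_abs, sq_abs, conj_trivial]
    linear_combination a * h4 + b * k4
  have hrhs : inner ℝ (H γ ξ - H γ ζ) (ξ - ζ)
      = (a - b) * (r - s) + (a * s + b * r) * (1 - inner ℝ e e') := by
    rw [h1, k1]
    rw [h2, k2]
    simp only [inner_sub_left, inner_sub_right, inner_smul_left, inner_smul_right,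
      real_inner_self_eq_norm_sq, conj_trivial, real_inner_comm e e']
    linear_combination r * h4 + s * k4
  have hab : 2 * (a * b) ≤ C * (a * s + b * r) := by
    nlinarith [mul_le_mul_of_nonneg_left k8 ha0, mul_le_mul_of_nonneg_left h8 hb0]
  rw [hlhs, hrhs]
  nlinarith [mul_le_mul_of_nonneg_right hab (sub_nonneg.2 hc)]

lemma measurable_H (γ : ℝ) : Measurable (H γ : E n → E n) := by
  have : (H γ : E n → E n) = fun ξ => profile γ ‖ξ‖ • (‖ξ‖⁻¹ • ξ) := funext (H_eq γ)
  rw [this]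
  unfold profile
  fun_prop

/-! ### Gradients of Lipschitz functions and integration by parts -/

lemma measurable_gradient (f : E n → ℝ) : Measurable (gradient f) :=
  (InnerProductSpace.toDual ℝ (E n)).symm.continuous.measurable.comp (measurable_fderiv ℝ f)

lemma norm_gradient_le {f : E n → ℝ} {C : NNReal} (hf : LipschitzWith C f) (x : E n) :
    ‖gradient f x‖ ≤ C := by
  rw [gradient, LinearIsometryEquiv.norm_map]
  exact norm_fderiv_le_of_lipschitz ℝ hf

lemma gradient_eq_zero_of_notMem_tsupport {f : E n → ℝ} {x : E n} (hx : x ∉ tsupport f) :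
    gradient f x = 0 := by
  have h : f =ᶠ[𝓝 x] fun _ => 0 := notMem_tsupport_iff_eventuallyEq.1 hx
  rw [h.gradient_eq, gradient_fun_const]

lemma lineDeriv_eq_inner_gradient {f : E n → ℝ} {x : E n} (h : DifferentiableAt ℝ f x) (e : E n) :
    lineDeriv ℝ f x e = inner ℝ (gradient f x) e := by
  rw [h.lineDeriv_eq_fderiv, inner_gradient_left]

lemma integrable_of_bounded {F : Type*} [NormedAddCommGroup F] {g : E n → F} {B : ℝ}
    {K : Set (E n)} (hg : AEStronglyMeasurable g volume) (hB : ∀ x, ‖g x‖ ≤ B)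
    (hK : IsCompact K) (hs : ∀ x, x ∉ K → g x = 0) : Integrable g volume := by
  rw [← integrableOn_iff_integrable_of_support_subset (s := K)
    (fun x hx => by_contra fun h => hx (hs x h))]
  exact Measure.integrableOn_of_bounded hK.measure_lt_top.ne hg (Eventually.of_forall hB)

/-- Integration by parts along one direction; by Rademacher's theorem the line derivatives are
components of the gradient almost everywhere. -/
lemma integral_mul_inner_gradient {f g : E n → ℝ} {C D : NNReal} (hf : LipschitzWith C f)
    (hg : LipschitzWith D g) (hgs : HasCompactSupport g) (e : E n) :
    ∫ x, f x * inner ℝ (gradient g x) e = - ∫ x, g x * inner ℝ (gradient f x) e := by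
  have h := LipschitzWith.integral_lineDeriv_mul_eq (μ := volume) hf hg hgs e
  rw [integral_congr_ae (g := fun x => g x * inner ℝ (gradient f x) e), integral_congr_ae
    (f := fun x => lineDeriv ℝ g x (-e) * f x)
    (g := fun x => -(f x * inner ℝ (gradient g x) e)), integral_neg] at h
  · linarith
  · filter_upwards [hg.ae_differentiableAt (μ := volume)] with x hx
    rw [lineDeriv_eq_inner_gradient hx, inner_neg_right]
    ring
  · filter_upwards [hf.ae_differentiableAt (μ := volume)] with x hx
    rw [lineDeriv_eq_inner_gradient hx, mul_comm]

lemma integrable_smul_gradient {f g : E n → ℝ} {D : NNReal} (hf : Continuous f)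
    (hg : LipschitzWith D g) (hgs : HasCompactSupport f ∨ HasCompactSupport g) :
    Integrable (fun x => f x • gradient g x) volume := by
  have hm : AEStronglyMeasurable (fun x => f x • gradient g x) volume :=
    (hf.measurable.smul (measurable_gradient g)).aestronglyMeasurable
  obtain ⟨K, hK, hs⟩ : ∃ K, IsCompact K ∧ ∀ x, x ∉ K → f x • gradient g x = 0 := by
    rcases hgs with h | h
    · exact ⟨tsupport f, h, fun x hx => by rw [image_eq_zero_of_notMem_tsupport hx, zero_smul]⟩
    · exact ⟨tsupport g, h, fun x hx => by
        rw [gradient_eq_zero_of_notMem_tsupport hx, smul_zero]⟩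
  obtain ⟨B, hB⟩ := hK.exists_bound_of_continuousOn hf.continuousOn
  refine integrable_of_bounded (B := max B 0 * D) hm (fun x => ?_) hK hs
  by_cases hx : x ∈ K
  · rw [norm_smul]
    exact mul_le_mul ((hB x hx).trans (le_max_left _ _)) (norm_gradient_le hg x) (norm_nonneg _)
      (le_max_right _ _)
  · rw [hs x hx, norm_zero]
    positivity

lemma integral_smul_gradient {f g : E n → ℝ} {C D : NNReal} (hf : LipschitzWith C f)
    (hg : LipschitzWith D g) (hgs : HasCompactSupport g) :
    ∫ x, f x • gradient g x = - ∫ x, g x • gradient f x := by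
  refine ext_inner_left ℝ fun e => ?_
  rw [inner_neg_right, ← integral_inner (integrable_smul_gradient hf.continuous hg (.inr hgs)),
    ← integral_inner (integrable_smul_gradient hg.continuous hf (.inl hgs))]
  simp only [real_inner_comm _ e, inner_smul_left, conj_trivial]
  exact integral_mul_inner_gradient hf hg hgs e

lemma setIntegral_eq_of_tsupport {F : Type*} [NormedAddCommGroup F] [NormedSpace ℝ F]
    {U : Set (E n)} {φ : E n → ℝ} (hs : tsupport φ ⊆ U) {g : E n → F}
    (hg : ∀ x, x ∉ tsupport φ → g x = 0) : ∫ x in U, g x = ∫ x, g x :=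
  setIntegral_eq_integral_of_forall_compl_eq_zero fun x hx => hg x fun h => hx (hs h)

lemma IsTestFunction.lipschitz {U : Set (E n)} {φ : E n → ℝ} (h : IsTestFunction U φ) :
    ∃ C, LipschitzWith C φ :=
  ContDiff.lipschitzWith_of_hasCompactSupport h.2.1 h.1 (by simp)

lemma hasWeakGradient_of_lipschitz {f : E n → ℝ} {C : NNReal} (hf : LipschitzWith C f)
    (U : Set (E n)) : HasWeakGradient U f (gradient f) := by
  refine ⟨hf.continuous.locallyIntegrable.locallyIntegrableOn U, ?_, fun φ hφ => ?_⟩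
  · exact ((memLp_top_of_bound (measurable_gradient f).aestronglyMeasurable C
      (Eventually.of_forall (norm_gradient_le hf))).locallyIntegrable le_top).locallyIntegrableOn U
  · obtain ⟨D, hD⟩ := hφ.lipschitz
    rw [setIntegral_eq_of_tsupport hφ.2.2, setIntegral_eq_of_tsupport hφ.2.2,
      integral_smul_gradient hf hD hφ.2.1]
    · intro x hx
      rw [image_eq_zero_of_notMem_tsupport hx, zero_smul]
    · intro x hx
      rw [gradient_eq_zero_of_notMem_tsupport hx, smul_zero]

/-! ### Mollification and Lipschitz test functions -/

/-- A sequence of bump functions shrinking to the origin, supported in the ball of radius `δ`. -/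
noncomputable def bump (n : ℕ) {δ : ℝ} (hδ : 0 < δ) (k : ℕ) : ContDiffBump (0 : E n) where
  -- The ratio of the radii is fixed at 2, as the almost everywhere convergence in
  -- `ae_tendsto_mollify` requires.
  rIn := δ / (2 * (k + 1))
  rOut := δ / (k + 1)
  rIn_pos := by positivity
  rIn_lt_rOut := by
    have : (0 : ℝ) < k + 1 := by positivity
    exact div_lt_div_of_pos_left hδ this (by linarith)

lemma tendsto_bump_rOut {δ : ℝ} (hδ : 0 < δ) :
    Tendsto (fun k => (bump n hδ k).rOut) atTop (𝓝 0) := by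
  have := (tendsto_one_div_add_atTop_nhds_zero_nat (𝕜 := ℝ)).const_mul δ
  simpa [bump, mul_one_div, div_eq_mul_inv] using this

lemma bump_rOut_le {δ : ℝ} (hδ : 0 < δ) (k : ℕ) : (bump n hδ k).rOut ≤ δ :=
  div_le_self hδ.le (by linarith [(Nat.cast_nonneg k : (0 : ℝ) ≤ k)])

lemma bump_rOut_eq {δ : ℝ} (hδ : 0 < δ) (k : ℕ) :
    (bump n hδ k).rOut = 2 * (bump n hδ k).rIn := by
  have : (0 : ℝ) < k + 1 := by positivity
  change δ / (k + 1) = 2 * (δ / (2 * (k + 1)))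
  field_simp

/-- Mollification. -/
noncomputable def mollify {F : Type*} [NormedAddCommGroup F] [NormedSpace ℝ F]
    {δ : ℝ} (hδ : 0 < δ) (k : ℕ) (g : E n → F) (x : E n) : F :=
  ∫ t, (bump n hδ k).normed volume t • g (x - t)

section mollify

variable {F : Type*} [NormedAddCommGroup F] [NormedSpace ℝ F] {δ : ℝ} (hδ : 0 < δ) (k : ℕ)

lemma mollify_eq_convolution (g : E n → F) : mollify hδ k g =
    convolution ((bump n hδ k).normed volume) g (ContinuousLinearMap.lsmul ℝ ℝ) volume := rfl

lemma integrable_bump : Integrable ((bump n hδ k).normed volume) volume :=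
  (bump n hδ k).integrable_normed

lemma norm_mollify_le {g : E n → F} {C : ℝ} (hg : ∀ x, ‖g x‖ ≤ C) (x : E n) :
    ‖mollify hδ k g x‖ ≤ C := by
  have h := norm_integral_le_of_norm_le ((integrable_bump (n := n) hδ k).mul_const C)
    (f := fun t => (bump n hδ k).normed volume t • g (x - t)) (Eventually.of_forall fun t => by
      rw [norm_smul, Real.norm_of_nonneg ((bump n hδ k).nonneg_normed t)]
      exact mul_le_mul_of_nonneg_left (hg _) ((bump n hδ k).nonneg_normed t))
  rwa [integral_mul_const, (bump n hδ k).integral_normed, one_mul] at h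

lemma mollify_eq_zero {g : E n → F} {x : E n} (hx : x ∉ Metric.cthickening δ (tsupport g)) :
    mollify hδ k g x = 0 := by
  refine integral_eq_zero_of_ae (Eventually.of_forall fun t => ?_)
  by_cases ht : t ∈ Metric.ball (0 : E n) (bump n hδ k).rOut
  · have : x - t ∉ tsupport g := fun h => hx (Metric.mem_cthickening_of_dist_le _ _ _ _ h (by
      rw [dist_eq_norm, sub_sub_cancel]
      exact (mem_ball_zero_iff.1 ht).le.trans (bump_rOut_le hδ k)))
    simp [image_eq_zero_of_notMem_tsupport this]
  · rw [← (bump n hδ k).support_normed_eq (μ := volume), Function.notMem_support] at ht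
    simp [ht]

lemma contDiff_mollify {g : E n → F} (hg : LocallyIntegrable g volume) :
    ContDiff ℝ ∞ (mollify hδ k g) := by
  rw [mollify_eq_convolution]
  exact (bump n hδ k).hasCompactSupport_normed.contDiff_convolution_left _
    (bump n hδ k).contDiff_normed hg

lemma ae_tendsto_mollify [CompleteSpace F] {g : E n → F} (hg : LocallyIntegrable g volume) :
    ∀ᵐ x, Tendsto (fun k => mollify hδ k g x) atTop (𝓝 (g x)) :=
  ContDiffBump.ae_convolution_tendsto_right_of_locallyIntegrable (K := 2) (tendsto_bump_rOut hδ)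
    (Eventually.of_forall fun k => (bump_rOut_eq hδ k).le) hg

lemma tendsto_mollify [CompleteSpace F] {g : E n → F} (hg : Continuous g) (x : E n) :
    Tendsto (fun k => mollify hδ k g x) atTop (𝓝 (g x)) :=
  ContDiffBump.convolution_tendsto_right_of_continuous (tendsto_bump_rOut hδ) hg x

end mollify

/-- The derivative falls on f: the difference quotients of f are dominated by C, and f is
differentiable at x - t for almost every t. -/
lemma gradient_mollify {f : E n → ℝ} {C : NNReal} (hf : LipschitzWith C f)
    {δ : ℝ} (hδ : 0 < δ) (k : ℕ) (x : E n) :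
    gradient (mollify hδ k f) x = mollify hδ k (gradient f) x := by
  set ρ := (bump n hδ k).normed volume with hρ
  have hρc : Continuous ρ := (bump n hδ k).continuous_normed
  have hρi : Integrable ρ volume := integrable_bump hδ k
  have hρ0 : ∀ t, 0 ≤ ρ t := (bump n hδ k).nonneg_normed
  have hρs : HasCompactSupport ρ := (bump n hδ k).hasCompactSupport_normed
  have hfd : ∀ᵐ t, DifferentiableAt ℝ f (x - t) :=
    (Measure.measurePreserving_sub_left volume x).quasiMeasurePreserving.ae
      hf.ae_differentiableAt
  have hmeas : Measurable (fun t => ρ t • fderiv ℝ f (x - t)) :=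
    hρc.measurable.smul ((measurable_fderiv ℝ f).comp (measurable_const.sub measurable_id))
  have h := hasFDerivAt_integral_of_dominated_loc_of_lip' (μ := volume) (𝕜 := ℝ)
    (F := fun y t => ρ t • f (y - t)) (F' := fun t => ρ t • fderiv ℝ f (x - t)) (x₀ := x)
    (bound := fun t => ρ t * C) (s := Set.univ) univ_mem
    (fun y _ => (hρc.smul (hf.continuous.comp (by fun_prop))).aestronglyMeasurable)
    ((hρc.smul (hf.continuous.comp (by fun_prop))).integrable_of_hasCompactSupport
      (hρs.smul_right))
    hmeas.aestronglyMeasurable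
    (Eventually.of_forall fun t y _ => by
      rw [← smul_sub, norm_smul, Real.norm_of_nonneg (hρ0 t), mul_assoc]
      refine mul_le_mul_of_nonneg_left ?_ (hρ0 t)
      have := hf.norm_sub_le (y - t) (x - t)
      rwa [sub_sub_sub_cancel_right] at this)
    (hρi.mul_const _) (by
      filter_upwards [hfd] with t ht
      have h0 := ht.hasFDerivAt.comp x ((hasFDerivAt_id x).sub_const t)
      rw [ContinuousLinearMap.comp_id] at h0
      exact h0.const_smul (ρ t))
  have h2 : fderiv ℝ (mollify hδ k f) x = ∫ t, ρ t • fderiv ℝ f (x - t) := h.2.fderiv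
  rw [gradient, h2, ← LinearIsometryEquiv.coe_toContinuousLinearEquiv,
    ← ContinuousLinearEquiv.integral_comp_comm]
  refine integral_congr_ae (Eventually.of_forall fun t => ?_)
  simp [gradient, hρ]

/-- Dominated convergence, with B ^ q times the indicator of K as dominating function. -/
lemma tendsto_eLpNorm_zero {F : Type*} [NormedAddCommGroup F] {g : ℕ → E n → F} {B : ℝ}
    {K : Set (E n)} {q : ℝ≥0∞} (hq : q ≠ 0) (hq' : q ≠ ⊤) {μ : Measure (E n)}
    [IsFiniteMeasureOnCompacts μ]
    (hg : ∀ k, AEStronglyMeasurable (g k) μ) (hB : ∀ k x, ‖g k x‖ ≤ B)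
    (hK : IsCompact K) (hs : ∀ k x, x ∉ K → g k x = 0)
    (hlim : ∀ᵐ x ∂μ, Tendsto (fun k => g k x) atTop (𝓝 0)) :
    Tendsto (fun k => eLpNorm (g k) q μ) atTop (𝓝 0) := by
  have hq0 : 0 < q.toReal := ENNReal.toReal_pos hq hq'
  have h : Tendsto (fun k => ∫⁻ x, ‖g k x‖ₑ ^ q.toReal ∂μ) atTop (𝓝 (∫⁻ _, 0 ∂μ)) := by
    refine tendsto_lintegral_of_dominated_convergence'
      (fun x => K.indicator (fun _ => ENNReal.ofReal B ^ q.toReal) x)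
      (fun k => (hg k).enorm.pow_const _) (fun k => Eventually.of_forall fun x => ?_) ?_ ?_
    · by_cases hx : x ∈ K
      · simp only [Set.indicator_of_mem hx]
        gcongr
        rw [← ofReal_norm]
        exact ENNReal.ofReal_le_ofReal (hB k x)
      · simp [hs k x hx, hq0]
    · rw [lintegral_indicator hK.measurableSet, lintegral_const, Measure.restrict_apply_univ]
      exact ENNReal.mul_ne_top (ENNReal.rpow_ne_top_of_nonneg hq0.le ENNReal.ofReal_ne_top)
        hK.measure_lt_top.ne
    · filter_upwards [hlim] with x hx
      have h1 := (ENNReal.continuous_rpow_const (y := q.toReal)).tendsto 0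
      rw [ENNReal.zero_rpow_of_pos hq0] at h1
      have h2 : Tendsto (fun k => ‖g k x‖ₑ) atTop (𝓝 0) := by
        have := hx.enorm
        rwa [enorm_zero] at this
      exact h1.comp h2
  rw [lintegral_zero] at h
  have h1 := (ENNReal.continuous_rpow_const (y := 1 / q.toReal)).tendsto 0
  rw [ENNReal.zero_rpow_of_pos (by positivity)] at h1
  simp only [eLpNorm_eq_lintegral_rpow_enorm_toReal hq hq']
  exact h1.comp h

lemma memW1_of_lipschitz {q : ℝ≥0∞} {U : Set (E n)} {φ : E n → ℝ} {C : NNReal}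
    (hφ : LipschitzWith C φ) (hc : HasCompactSupport φ) : MemW1 q U φ (gradient φ) := by
  refine ⟨hasWeakGradient_of_lipschitz hφ U,
    (hφ.continuous.memLp_of_hasCompactSupport hc).restrict U, MemLp.restrict U ?_⟩
  have h : MemLp (gradient φ) ⊤ volume :=
    memLp_top_of_bound (measurable_gradient φ).aestronglyMeasurable C
      (Eventually.of_forall (norm_gradient_le hφ))
  exact h.mono_exponent_of_measure_support_ne_top (s := tsupport φ)
    (fun x hx => gradient_eq_zero_of_notMem_tsupport hx) (IsCompact.measure_lt_top hc).ne le_top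

/-- Lipschitz functions with compact support in `U` belong to `W^{1,q}_0(U)`. -/
theorem memW1Zero_of_lipschitz {q : ℝ≥0∞} (hq : q ≠ 0) (hq' : q ≠ ⊤) {U : Set (E n)}
    (hU : IsOpen U) {φ : E n → ℝ} {C : NNReal} (hφ : LipschitzWith C φ)
    (hc : HasCompactSupport φ) (hs : tsupport φ ⊆ U) : MemW1Zero q U φ (gradient φ) := by
  obtain ⟨δ, hδ, hδU⟩ := IsCompact.exists_cthickening_subset_open hc hU hs
  set K := Metric.cthickening δ (tsupport φ) with hKdef
  have hK : IsCompact K := IsCompact.cthickening hc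
  have hφK : tsupport φ ⊆ K := Metric.self_subset_cthickening _
  have hsupp : ∀ k, tsupport (mollify hδ k φ) ⊆ K := fun k =>
    closure_minimal (fun x hx => by_contra fun h => hx (mollify_eq_zero hδ k h)) hK.isClosed
  have hgl : LocallyIntegrable (gradient φ) volume :=
    (memLp_top_of_bound (measurable_gradient φ).aestronglyMeasurable C
      (Eventually.of_forall (norm_gradient_le hφ))).locallyIntegrable le_top
  have hsm : ∀ k, ContDiff ℝ ∞ (mollify hδ k φ) := fun k =>
    contDiff_mollify hδ k hφ.continuous.locallyIntegrable
  obtain ⟨B, hB⟩ := hφ.continuous.bounded_above_of_compact_support hc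
  refine ⟨memW1_of_lipschitz hφ hc, fun k => mollify hδ k φ, fun k =>
    ⟨hsm k, hK.of_isClosed_subset (isClosed_tsupport _) (hsupp k), (hsupp k).trans hδU⟩, ?_, ?_⟩
  · refine tendsto_eLpNorm_zero (B := B + B) (K := K) hq hq' (fun k => ?_) (fun k x => ?_) hK
      (fun k x hx => ?_) (Eventually.of_forall fun x => ?_)
    · exact ((hsm k).continuous.sub hφ.continuous).aestronglyMeasurable
    · exact (norm_sub_le _ _).trans (add_le_add (norm_mollify_le hδ k hB x) (hB x))
    · change mollify hδ k φ x - φ x = 0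
      rw [image_eq_zero_of_notMem_tsupport fun h => hx (hsupp k h),
        image_eq_zero_of_notMem_tsupport fun h => hx (hφK h), sub_zero]
    · simpa using (tendsto_mollify hδ hφ.continuous x).sub_const (φ x)
  · refine tendsto_eLpNorm_zero (B := C + C) (K := K) hq hq' (fun k => ?_) (fun k x => ?_) hK
      (fun k x hx => ?_) (ae_restrict_of_ae ?_)
    · exact ((measurable_gradient _).sub (measurable_gradient _)).aestronglyMeasurable
    · rw [gradient_mollify hφ]
      exact (norm_sub_le _ _).trans
        (add_le_add (norm_mollify_le hδ k (norm_gradient_le hφ) x) (norm_gradient_le hφ x))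
    · rw [gradient_eq_zero_of_notMem_tsupport fun h => hx (hsupp k h),
        gradient_eq_zero_of_notMem_tsupport fun h => hx (hφK h), sub_zero]
    · filter_upwards [ae_tendsto_mollify hδ hgl] with x hx
      simp only [gradient_mollify hφ]
      simpa using hx.sub_const (gradient φ x)

/-! ### Functions with bounded weak gradient are locally Lipschitz -/

lemma gradient_mul {f g : E n → ℝ} {x : E n} (hf : DifferentiableAt ℝ f x)
    (hg : DifferentiableAt ℝ g x) :
    gradient (fun y => f y * g y) x = f x • gradient g x + g x • gradient f x := by
  rw [gradient, fderiv_fun_mul hf hg]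
  simp [gradient]

lemma gradient_sub {f g : E n → ℝ} {x : E n} (hf : DifferentiableAt ℝ f x)
    (hg : DifferentiableAt ℝ g x) :
    gradient (fun y => f y - g y) x = gradient f x - gradient g x := by
  rw [gradient, fderiv_fun_sub hf hg]
  simp [gradient]

lemma gradient_comp_add_right (f : E n → ℝ) (h x : E n) :
    gradient (fun y => f (y + h)) x = gradient f (x + h) := by
  rw [gradient, fderiv_comp_add_right, gradient]

/-- Here the derivative falls on the kernel, because w is only continuous; the reflected kernel then
serves as a test function for the weak gradient of w. -/
lemma fderiv_mollify {w : E n → ℝ} (hw : Continuous w) {δ : ℝ} (hδ : 0 < δ) (k : ℕ) (x e : E n) :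
    fderiv ℝ (mollify hδ k w) x e =
      - ∫ y, w y * inner ℝ (gradient (fun z => (bump n hδ k).normed volume (x - z)) y) e := by
  set ρ := (bump n hδ k).normed volume with hρ
  have hρd : ContDiff ℝ 1 ρ := (bump n hδ k).contDiff_normed
  have hρs : HasCompactSupport ρ := (bump n hδ k).hasCompactSupport_normed
  have h := hρs.hasFDerivAt_convolution_left (ContinuousLinearMap.lsmul ℝ ℝ) hρd
    (hw.locallyIntegrable (μ := volume)) x
  have hint := (hρs.fderiv ℝ).convolutionExists_left
    ((ContinuousLinearMap.lsmul ℝ ℝ).precompL (E n)) (hρd.continuous_fderiv one_ne_zero)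
    (hw.locallyIntegrable (μ := volume)) x
  rw [mollify_eq_convolution, h.fderiv, convolution, ContinuousLinearMap.integral_apply hint,
    ← integral_neg, ← integral_sub_left_eq_self _ volume x]
  refine integral_congr_ae (Eventually.of_forall fun y => ?_)
  have hy : HasFDerivAt (fun z => ρ (x - z)) (-(fderiv ℝ ρ (x - y))) y := by
    have h0 := (hρd.differentiable one_ne_zero (x - y)).hasFDerivAt.comp y
      ((hasFDerivAt_id y).const_sub x)
    rw [ContinuousLinearMap.comp_neg, ContinuousLinearMap.comp_id] at h0
    exact h0
  simp only [ContinuousLinearMap.precompL_apply, sub_sub_cancel, inner_gradient_left, hy.fderiv]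
  simp [mul_comm]

/-- A continuous function with bounded weak gradient is Lipschitz. -/
theorem lipschitz_of_hasWeakGradient {w : E n → ℝ} {G : E n → E n} {M : NNReal}
    (hw : Continuous w) (hG : ∀ᵐ x, ‖G x‖ ≤ M) (h : HasWeakGradient Set.univ w G) :
    LipschitzWith M w := by
  have hsm : ∀ k, ContDiff ℝ ∞ (mollify one_pos k w) := fun k =>
    contDiff_mollify one_pos k hw.locallyIntegrable
  have hk : ∀ k, LipschitzWith M (mollify one_pos k w) := by
    refine fun k => lipschitzWith_of_nnnorm_fderiv_le (𝕜 := ℝ)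
      ((hsm k).differentiable (by simp)) fun x => ?_
    refine ContinuousLinearMap.opNorm_le_bound _ M.2 fun e => ?_
    -- Tested with ψ, the weak gradient gives the derivative of the mollification at x in direction
    -- e as the inner product of e with the average of G against ψ. As ψ ≥ 0 has integral 1, this is
    -- at most M * ‖e‖, uniformly in k.
    set ψ := fun z => (bump n one_pos k).normed volume (x - z) with hψ
    have hψt : IsTestFunction Set.univ ψ := by
      refine ⟨(bump n one_pos k).contDiff_normed.comp (contDiff_const.sub contDiff_id), ?_,
        Set.subset_univ _⟩
      exact (bump n one_pos k).hasCompactSupport_normed.comp_homeomorph (Homeomorph.subLeft x)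
    obtain ⟨D, hD⟩ := hψt.lipschitz
    have h1 := h.2.2 ψ hψt
    rw [setIntegral_univ, setIntegral_univ] at h1
    have h2 : ‖∫ y, ψ y • G y‖ ≤ M := by
      have hψi : Integrable ψ volume :=
        hψt.1.continuous.integrable_of_hasCompactSupport hψt.2.1
      have h3 := norm_integral_le_of_norm_le (hψi.mul_const (M : ℝ)) (f := fun y => ψ y • G y) (by
        filter_upwards [hG] with y hy
        have h0 : 0 ≤ ψ y := (bump n one_pos k).nonneg_normed _
        rw [norm_smul, Real.norm_of_nonneg h0]
        exact mul_le_mul_of_nonneg_left hy h0)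
      rwa [integral_mul_const, hψ, integral_sub_left_eq_self _ volume x,
        (bump n one_pos k).integral_normed, one_mul] at h3
    have h4 : ∫ y, w y * inner ℝ (gradient ψ y) e = inner ℝ (∫ y, w y • gradient ψ y) e := by
      rw [real_inner_comm, ← integral_inner (integrable_smul_gradient hw hD (.inr hψt.2.1))]
      simp only [inner_smul_right, real_inner_comm]
    rw [fderiv_mollify hw, h4, h1, inner_neg_left, neg_neg]
    exact (norm_inner_le_norm _ _).trans (mul_le_mul_of_nonneg_right h2 (norm_nonneg _))
  refine LipschitzWith.of_dist_le_mul fun x y => ?_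
  exact le_of_tendsto ((tendsto_mollify one_pos hw x).dist (tendsto_mollify one_pos hw y))
    (Eventually.of_forall fun k => (hk k).dist_le_mul x y)

lemma ae_eq_gradient_of_hasWeakGradient {w : E n → ℝ} {G : E n → E n} {M : NNReal}
    (hw : LipschitzWith M w) (h : HasWeakGradient Set.univ w G) : ∀ᵐ x, G x = gradient w x := by
  have h' := hasWeakGradient_of_lipschitz hw Set.univ
  refine ae_eq_of_integral_contDiff_smul_eq (locallyIntegrableOn_univ.1 h.2.1)
    (locallyIntegrableOn_univ.1 h'.2.1) fun φ hφ hφs => ?_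
  have h1 := h.2.2 φ ⟨hφ, hφs, Set.subset_univ _⟩
  have h2 := h'.2.2 φ ⟨hφ, hφs, Set.subset_univ _⟩
  rw [setIntegral_univ, setIntegral_univ] at h1 h2
  exact neg_injective (h1.symm.trans h2)

/-- The value 1 is required on a neighbourhood of K so that the gradient of the cutoff vanishes on
K. -/
lemma exists_cutoff {K Ω : Set (E n)} (hK : IsCompact K) (hΩ : IsOpen Ω) (hKΩ : K ⊆ Ω) :
    ∃ χ : E n → ℝ, IsTestFunction Ω χ ∧ (∀ᶠ x in 𝓝ˢ K, χ x = 1) ∧ ∀ x, χ x ∈ Set.Icc 0 1 := by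
  obtain ⟨W, hW, hKW, hWΩ, hWc⟩ := exists_open_between_and_isCompact_closure hK hΩ hKΩ
  obtain ⟨χ, h1, h0, hI⟩ := exists_contMDiffMap_one_nhds_of_subset_interior
    (modelWithCornersSelf ℝ (E n)) (n := (⊤ : ℕ∞)) hK.isClosed
    (hKW.trans (interior_maximal subset_closure hW))
  have hs : tsupport χ ⊆ closure W :=
    closure_minimal (fun x hx => by_contra fun h => hx (h0 x h)) isClosed_closure
  exact ⟨χ, ⟨χ.contMDiff.contDiff, hWc.of_isClosed_subset (isClosed_tsupport _) hs,
    hs.trans hWΩ⟩, h1, hI⟩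

lemma norm_le_of_memLp_top {F : Type*} [NormedAddCommGroup F] {μ : Measure (E n)} {g : E n → F}
    (h : MemLp g ⊤ μ) : ∃ M : ℝ, 0 ≤ M ∧ ∀ᵐ x ∂μ, ‖g x‖ ≤ M := by
  refine ⟨(eLpNorm g ⊤ μ).toReal, ENNReal.toReal_nonneg, ?_⟩
  filter_upwards [ae_le_eLpNormEssSup (f := g) (μ := μ)] with x hx
  rw [← eLpNorm_exponent_top] at hx
  rw [← toReal_enorm]
  exact ENNReal.toReal_mono h.2.ne hx

/-- The weak gradient of a product with a test function. -/
lemma hasWeakGradient_cutoff_mul {Ω : Set (E n)} {u : E n → ℝ} {Du : E n → E n} (hΩ : IsOpen Ω)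
    (hu : ContinuousOn u Ω) (hW : HasWeakGradient Ω u Du) {χ : E n → ℝ}
    (hχ : IsTestFunction Ω χ) (h1 : Integrable (fun x => χ x • Du x) volume)
    (h2 : Integrable (fun x => u x • gradient χ x) volume) :
    HasWeakGradient Set.univ (fun x => χ x * u x)
      (fun x => χ x • Du x + u x • gradient χ x) := by
  have hts : tsupport (fun x => χ x * u x) ⊆ tsupport χ := tsupport_mul_subset_left
  have hc : Continuous (fun x => χ x * u x) :=
    (hχ.1.continuous.continuousOn.mul hu).continuous_of_tsupport_subset hΩ (hts.trans hχ.2.2)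
  refine ⟨hc.locallyIntegrable.locallyIntegrableOn _,
    (h1.add h2).locallyIntegrable.locallyIntegrableOn _, fun ψ hψ => ?_⟩
  obtain ⟨D, hD⟩ := hψ.lipschitz
  obtain ⟨B, hB⟩ := hψ.1.continuous.bounded_above_of_compact_support hψ.2.1
  -- The weak gradient of u is tested with χψ; the product rule produces the extra term with the
  -- gradient of χ.
  have hprod : IsTestFunction Ω (fun x => χ x * ψ x) :=
    ⟨hχ.1.mul hψ.1, hχ.2.1.mul_right, tsupport_mul_subset_left.trans hχ.2.2⟩
  have h3 := hW.2.2 _ hprod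
  have hz : ∀ x, x ∉ tsupport χ → χ x = 0 ∧ gradient χ x = 0 := fun x hx =>
    ⟨image_eq_zero_of_notMem_tsupport hx, gradient_eq_zero_of_notMem_tsupport hx⟩
  have hgr : ∀ x, gradient (fun x => χ x * ψ x) x = χ x • gradient ψ x + ψ x • gradient χ x :=
    fun x => gradient_mul (hχ.1.differentiable (by simp) x) (hψ.1.differentiable (by simp) x)
  simp only [hgr] at h3
  rw [setIntegral_eq_of_tsupport hχ.2.2 (fun x hx => by simp [hz x hx]),
    setIntegral_eq_of_tsupport hχ.2.2 (fun x hx => by simp [hz x hx])] at h3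
  have i1 : Integrable (fun x => (χ x * u x) • gradient ψ x) volume :=
    integrable_smul_gradient hc hD (.inr hψ.2.1)
  have i2 : Integrable (fun x => ψ x • u x • gradient χ x) volume :=
    h2.bdd_smul B hψ.1.continuous.aestronglyMeasurable (Eventually.of_forall hB)
  have i3 : Integrable (fun x => ψ x • χ x • Du x) volume :=
    h1.bdd_smul B hψ.1.continuous.aestronglyMeasurable (Eventually.of_forall hB)
  have e1 : ∫ x, u x • (χ x • gradient ψ x + ψ x • gradient χ x) =
      (∫ x, (χ x * u x) • gradient ψ x) + ∫ x, ψ x • u x • gradient χ x := by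
    rw [← integral_add i1 i2]
    refine integral_congr_ae (Eventually.of_forall fun x => ?_)
    simp only [smul_add, smul_smul, mul_comm]
  have e2 : ∫ x, (χ x * ψ x) • Du x = ∫ x, ψ x • χ x • Du x := by
    simp only [smul_smul, mul_comm]
  rw [setIntegral_univ, setIntegral_univ]
  simp only [smul_add]
  rw [integral_add i3 i2]
  rw [e1, e2] at h3
  rw [eq_sub_of_add_eq h3]
  abel

/-- A continuous function in `W^{1,∞}_loc(Ω)` agrees on `V ⋐ Ω` with a globally Lipschitz
function. -/
theorem exists_lipschitz_extension {Ω V : Set (E n)} (hΩ : IsOpen Ω) {u : E n → ℝ}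
    {Du : E n → E n} (hu : ContinuousOn u Ω) (hW : MemW1Loc ⊤ Ω u Du)
    (hV : IsOpen V) (hVΩ : CompactlyContained V Ω) :
    ∃ (C : NNReal) (w : E n → ℝ), LipschitzWith C w ∧ (∃ B, ∀ x, ‖w x‖ ≤ B) ∧ Set.EqOn w u V ∧
      ∀ᵐ x ∂volume.restrict V, Du x = gradient w x := by
  obtain ⟨χ, hχ, hχ1, hχI⟩ := exists_cutoff hVΩ.1 hΩ hVΩ.2
  -- The extension is χu. Both u and Du are bounded on W, which contains the support of χ, so χu has
  -- a bounded weak gradient on the whole space.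
  obtain ⟨W, hWo, hKW, hWΩ, hWc⟩ := exists_open_between_and_isCompact_closure hχ.2.1 hΩ hχ.2.2
  have hWcc : CompactlyContained W Ω := ⟨hWc, hWΩ⟩
  have hDu := (hW.2 W hWo hWcc).2.2
  have huW : ContinuousOn u (closure W) := hu.mono hWΩ
  have : IsFiniteMeasure (volume.restrict W) :=
    isFiniteMeasure_restrict.2
      (hWc.measure_lt_top.trans_le' (measure_mono subset_closure)).ne
  obtain ⟨D, hD⟩ := hχ.lipschitz
  obtain ⟨M, hM0, hM⟩ := norm_le_of_memLp_top hDu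
  obtain ⟨B, hB⟩ := hWc.exists_bound_of_continuousOn huW
  have hz : ∀ x, x ∉ tsupport χ → χ x = 0 ∧ gradient χ x = 0 := fun x hx =>
    ⟨image_eq_zero_of_notMem_tsupport hx, gradient_eq_zero_of_notMem_tsupport hx⟩
  have hχb : ∀ x, ‖χ x‖ ≤ 1 := fun x => by
    rw [Real.norm_of_nonneg (hχI x).1]
    exact (hχI x).2
  have h1 : Integrable (fun x => χ x • Du x) volume := by
    rw [← integrableOn_iff_integrable_of_support_subset (s := W) fun x hx =>
      hKW (by_contra fun h => hx (by simp [hz x h]))]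
    exact (hDu.integrable le_top).bdd_smul 1 hχ.1.continuous.aestronglyMeasurable
      (Eventually.of_forall hχb)
  have hB' : ∀ x ∈ W, ‖u x‖ ≤ max B 0 := fun x hx => (hB x (subset_closure hx)).trans
    (le_max_left _ _)
  have h2 : Integrable (fun x => u x • gradient χ x) volume := by
    rw [← integrableOn_iff_integrable_of_support_subset (s := W) fun x hx =>
      hKW (by_contra fun h => hx (by simp [hz x h]))]
    have hi : IntegrableOn (gradient χ) W volume := Measure.integrableOn_of_bounded (M := D)
      (hWc.measure_lt_top.trans_le' (measure_mono subset_closure)).ne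
      (measurable_gradient χ).aestronglyMeasurable (Eventually.of_forall (norm_gradient_le hD))
    have hm : AEStronglyMeasurable u (volume.restrict W) :=
      (huW.mono subset_closure).aestronglyMeasurable hWo.measurableSet
    exact hi.bdd_smul (max B 0) hm
      ((ae_restrict_iff' hWo.measurableSet).2 (Eventually.of_forall hB'))
  have hwg := hasWeakGradient_cutoff_mul hΩ hu hW.1 hχ h1 h2
  have hts : tsupport (fun x => χ x * u x) ⊆ tsupport χ := tsupport_mul_subset_left
  have hc : Continuous (fun x => χ x * u x) :=
    (hχ.1.continuous.continuousOn.mul hu).continuous_of_tsupport_subset hΩ (hts.trans hχ.2.2)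
  have hbd : ∀ᵐ x, ‖χ x • Du x + u x • gradient χ x‖ ≤
      (⟨M + max B 0 * D, by positivity⟩ : NNReal) := by
    filter_upwards [(ae_restrict_iff' hWo.measurableSet).1 hM] with x hx
    by_cases hxχ : x ∈ tsupport χ
    · refine (norm_add_le _ _).trans (add_le_add ?_ ?_)
      · rw [norm_smul]
        exact (mul_le_mul (hχb x) (hx (hKW hxχ)) (norm_nonneg _) zero_le_one).trans (one_mul _).le
      · rw [norm_smul]
        exact mul_le_mul (hB' x (hKW hxχ)) (norm_gradient_le hD x) (norm_nonneg _)
          (le_max_right _ _)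
    · simp only [hz x hxχ, zero_smul, smul_zero, add_zero, norm_zero]
      positivity
  have hlip := lipschitz_of_hasWeakGradient hc hbd hwg
  have hχV : ∀ x ∈ V, χ =ᶠ[𝓝 x] fun _ => 1 := fun x hx =>
    eventually_nhdsSet_iff_forall.1 hχ1 x (subset_closure hx)
  refine ⟨_, _, hlip, hc.bounded_above_of_compact_support hχ.2.1.mul_right, fun x hx => by simp [(hχV x hx).eq_of_nhds], ?_⟩
  rw [ae_restrict_iff' hV.measurableSet]
  filter_upwards [ae_eq_gradient_of_hasWeakGradient hlip hwg] with x hx hxV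
  rw [← hx, (hχV x hxV).gradient_eq, gradient_fun_const, (hχV x hxV).eq_of_nhds]
  simp

/-! ### Difference quotients of H(Dw) -/

/-- The equation `-div H_γ(Dw) = g` in `U`, tested with compactly supported Lipschitz functions. -/
def WeakEquation (γ : ℝ) (w g : E n → ℝ) (U : Set (E n)) : Prop :=
  ∀ (C : NNReal) (φ : E n → ℝ), LipschitzWith C φ → HasCompactSupport φ → tsupport φ ⊆ U →
    ∫ x, inner ℝ (H γ (gradient w x)) (gradient φ x) = ∫ x, g x * φ x

lemma lipschitzWith_mul {f g : E n → ℝ} {C D : NNReal} {A B : ℝ} (hf : LipschitzWith C f)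
    (hg : LipschitzWith D g) (hA : ∀ x, ‖f x‖ ≤ A) (hB : ∀ x, ‖g x‖ ≤ B) :
    ∃ N, LipschitzWith N (fun x => f x * g x) := by
  have hA0 : 0 ≤ A := (norm_nonneg _).trans (hA 0)
  have hB0 : 0 ≤ B := (norm_nonneg _).trans (hB 0)
  refine ⟨⟨A * D + B * C, by positivity⟩, LipschitzWith.of_dist_le_mul fun x y => ?_⟩
  have h1 := hf.dist_le_mul x y
  have h2 := hg.dist_le_mul x y
  rw [Real.dist_eq] at h1 h2 ⊢
  calc |f x * g x - f y * g y| = |f x * (g x - g y) + g y * (f x - f y)| := by ring_nf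
    _ ≤ |f x| * |g x - g y| + |g y| * |f x - f y| := by
      rw [← abs_mul, ← abs_mul]
      exact abs_add_le _ _
    _ ≤ A * (D * dist x y) + B * (C * dist x y) :=
      add_le_add (mul_le_mul (hA x) h2 (abs_nonneg _) hA0)
        (mul_le_mul (hB y) h1 (abs_nonneg _) hB0)
    _ = (A * D + B * C) * dist x y := by ring

lemma lipschitzWith_comp_add_right {f : E n → ℝ} {C : NNReal} (hf : LipschitzWith C f) (h : E n) :
    LipschitzWith C (fun x => f (x + h)) := fun x y => by
  simpa using hf (x + h) (y + h)

lemma measurable_H_gradient (γ : ℝ) (w : E n → ℝ) :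
    Measurable (fun x => H γ (gradient w x)) :=
  (measurable_H γ).comp (measurable_gradient w)

lemma norm_H_gradient_le {γ : ℝ} (hγ : 0 < γ) {w : E n → ℝ} {C : NNReal}
    (hw : LipschitzWith C w) (x : E n) : ‖H γ (gradient w x)‖ ≤ profile γ C := by
  rw [norm_H hγ]
  exact profile_mono hγ.le (norm_gradient_le hw x)

/-- The equation is tested with φ and with its translate by h, and the variable is shifted in the
latter; δ keeps the translated support in U. -/
lemma WeakEquation.integral_difference {γ : ℝ} (hγ : 0 < γ) {w g : E n → ℝ} {U : Set (E n)}
    (heq : WeakEquation γ w g U) {C N : NNReal} (hw : LipschitzWith C w) (hg : Continuous g)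
    {φ : E n → ℝ} (hφ : LipschitzWith N φ) (hc : HasCompactSupport φ) {δ : ℝ}
    (hδ : Metric.cthickening δ (tsupport φ) ⊆ U) {h : E n} (hh : ‖h‖ ≤ δ) :
    ∫ x, inner ℝ (H γ (gradient w (x + h)) - H γ (gradient w x)) (gradient φ x) =
      ∫ x, (g (x + h) - g x) * φ x := by
  have hφs : tsupport φ ⊆ U := (Metric.self_subset_cthickening _).trans hδ
  have hlip : LipschitzWith N (fun x => φ (x + -h)) :=
    lipschitzWith_comp_add_right hφ _
  have hts : tsupport (fun x => φ (x + -h)) ⊆ Metric.cthickening δ (tsupport φ) := by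
    refine closure_minimal (fun x hx => ?_) Metric.isClosed_cthickening
    refine Metric.mem_cthickening_of_dist_le x (x + -h) _ _ (subset_tsupport _ hx) ?_
    rwa [dist_eq_norm, ← sub_eq_add_neg, sub_sub_cancel]
  have hcs : HasCompactSupport (fun x => φ (x + -h)) :=
    (IsCompact.cthickening hc).of_isClosed_subset (isClosed_tsupport _) hts
  have e1 := heq N φ hφ hc hφs
  have e2 := heq N _ hlip hcs (hts.trans hδ)
  rw [← integral_add_right_eq_self _ h, ← integral_add_right_eq_self (fun x => g x * _) h] at e2
  simp only [gradient_comp_add_right, add_neg_cancel_right] at e2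
  have hV := measurable_H_gradient γ w
  have hint : ∀ h : E n, Integrable
      (fun x => inner ℝ (H γ (gradient w (x + h))) (gradient φ x)) volume := fun h =>
    integrable_of_bounded (B := profile γ C * N) (K := tsupport φ)
      ((hV.comp (measurable_add_const h)).inner (measurable_gradient φ)).aestronglyMeasurable
      (fun x => (norm_inner_le_norm _ _).trans (mul_le_mul (norm_H_gradient_le hγ hw _)
        (norm_gradient_le hφ x) (norm_nonneg _) (profile_nonneg _ _))) hc
      (fun x hx => by rw [gradient_eq_zero_of_notMem_tsupport hx, inner_zero_right])
  have hint' : ∀ h : E n, Integrable (fun x => g (x + h) * φ x) volume := fun h =>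
    ((hg.comp (continuous_add_const h)).mul hφ.continuous).integrable_of_hasCompactSupport
      hc.mul_left
  have i1 := hint 0
  have i2 := hint' 0
  simp only [add_zero] at i1 i2
  simp only [inner_sub_left, sub_mul]
  rw [integral_sub (hint h) i1, integral_sub (hint' h) i2, e1, e2]

/-- To be read with X and Y the increments of H(Dw) and Dw, t the increment of w, Z the gradient of
the cutoff η, and T the gradient of η²t. Cocoercivity gives c⁻¹η²‖X‖², and Young's inequality lets
half of it absorb the cross term. -/
lemma difference_quotient_pointwise {c a N : ℝ} (hc : 0 < c) {η : ℝ} {X Y Z T : E n}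
    (hX : ‖X‖ ^ 2 ≤ c * inner ℝ X Y) (hZ : ‖Z‖ ≤ N) {t : ℝ} (ht : |t| ≤ a)
    (hT : T = (η * η) • Y + t • (η • Z + η • Z)) :
    (2 * c)⁻¹ * (η ^ 2 * ‖X‖ ^ 2) - 2 * c * N ^ 2 * a ^ 2 ≤ inner ℝ X T := by
  have hXZ : |inner ℝ X Z| ≤ ‖X‖ * N := (abs_real_inner_le_norm X Z).trans
    (mul_le_mul_of_nonneg_left hZ (norm_nonneg _))
  have h1 : inner ℝ X T = η ^ 2 * inner ℝ X Y + 2 * (t * η * inner ℝ X Z) := by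
    rw [hT]
    simp only [inner_add_right, inner_smul_right]
    ring
  have h2 : |t * η * inner ℝ X Z| ≤ a * |η| * (‖X‖ * N) := by
    rw [abs_mul, abs_mul]
    exact mul_le_mul (mul_le_mul_of_nonneg_right ht (abs_nonneg _)) hXZ (abs_nonneg _)
      (mul_nonneg ((abs_nonneg _).trans ht) (abs_nonneg _))
  have h3 : c⁻¹ * ‖X‖ ^ 2 ≤ inner ℝ X Y := by rwa [inv_mul_le_iff₀ hc]
  have h4 : η ^ 2 * (c⁻¹ * ‖X‖ ^ 2) ≤ η ^ 2 * inner ℝ X Y :=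
    mul_le_mul_of_nonneg_left h3 (sq_nonneg _)
  have h5 : 2 * (a * |η| * (‖X‖ * N)) ≤ (2 * c)⁻¹ * (η ^ 2 * ‖X‖ ^ 2) + 2 * c * N ^ 2 * a ^ 2 := by
    have h6 : 0 ≤ (2 * c)⁻¹ * (|η| * ‖X‖ - 2 * c * N * a) ^ 2 := by positivity
    have h7 : (2 * c)⁻¹ * (|η| * ‖X‖ - 2 * c * N * a) ^ 2 = (2 * c)⁻¹ * (|η| ^ 2 * ‖X‖ ^ 2)
        + 2 * c * N ^ 2 * a ^ 2 - 2 * (a * |η| * (‖X‖ * N)) := by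
      field_simp
      ring
    rw [sq_abs] at h7
    linarith
  have h8 : c⁻¹ = (2 * c)⁻¹ + (2 * c)⁻¹ := by
    field_simp
    norm_num
  rw [h1]
  rw [h8] at h4
  nlinarith [neg_abs_le (t * η * inner ℝ X Z)]

/-- The field `H(Dw)` has difference quotients bounded in `L²`. -/
theorem WeakEquation.difference_quotient {γ : ℝ} (hγ : 1 ≤ γ) {w g : E n → ℝ} {U : Set (E n)}
    (hU : IsOpen U) (heq : WeakEquation γ w g U) {C D : NNReal} (hw : LipschitzWith C w)
    (hg : LipschitzWith D g) {A : Set (E n)} (hA : IsCompact A) (hAU : A ⊆ U) :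
    ∃ M : ℝ, 0 ≤ M ∧ ∃ δ : ℝ, 0 < δ ∧ ∀ h : E n, ‖h‖ ≤ δ →
      ∫ x in A, ‖H γ (gradient w (x + h)) - H γ (gradient w x)‖ ^ 2 ≤ M * ‖h‖ ^ 2 := by
  have hγ0 : 0 < γ := by linarith
  obtain ⟨η, hη, hη1, hηI⟩ := exists_cutoff hA hU hAU
  obtain ⟨N, hN⟩ := hη.lipschitz
  obtain ⟨δ, hδ, hδU⟩ := IsCompact.exists_cthickening_subset_open hη.2.1 hU hη.2.2
  obtain ⟨c, hc, hcoc⟩ := H_cocoercive (n := n) hγ C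
  set K := tsupport η with hK
  set m := volume.real K with hm
  have hKfin : volume K ≠ ⊤ := (IsCompact.measure_lt_top hη.2.1).ne
  set V := fun x => H γ (gradient w x) with hVdef
  have hVm : Measurable V := measurable_H_gradient γ w
  have hVb : ∀ x, ‖V x‖ ≤ profile γ C := norm_H_gradient_le hγ0 hw
  have hP : 0 ≤ profile γ C := profile_nonneg _ _
  -- The term D * C comes from the right-hand side, 2 * c * N ^ 2 * C ^ 2 from the gradient of the
  -- cutoff; both are integrated over K, and 2 * c undoes the factor left after absorption.
  refine ⟨2 * c * ((D * C + 2 * c * N ^ 2 * C ^ 2) * m), by positivity, δ, hδ, fun h hh => ?_⟩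
  have hηb : ∀ x, ‖η x‖ ≤ 1 := fun x => by
    rw [Real.norm_of_nonneg (hηI x).1]
    exact (hηI x).2
  have hηz : ∀ x, x ∉ K → η x = 0 ∧ gradient η x = 0 := fun x hx =>
    ⟨image_eq_zero_of_notMem_tsupport hx, gradient_eq_zero_of_notMem_tsupport hx⟩
  have hwh : ∀ x, |w (x + h) - w x| ≤ C * ‖h‖ := fun x => by
    simpa using hw.norm_sub_le (x + h) x
  have hgh : ∀ x, |g (x + h) - g x| ≤ D * ‖h‖ := fun x => by
    simpa using hg.norm_sub_le (x + h) x
  have hw' : LipschitzWith C (fun x => w (x + h)) := lipschitzWith_comp_add_right hw h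
  obtain ⟨N1, hN1⟩ := lipschitzWith_mul hN hN hηb hηb
  have hηη : ∀ x, ‖η x * η x‖ ≤ 1 := fun x => by
    rw [norm_mul]
    exact mul_le_one₀ (hηb x) (norm_nonneg _) (hηb x)
  obtain ⟨N2, hN2⟩ := lipschitzWith_mul hN1 (hw'.sub hw) hηη hwh
  set φ := fun x => η x * η x * (w (x + h) - w x) with hφ
  have hts : tsupport φ ⊆ K := closure_minimal (fun x hx => by
    by_contra hxK
    exact hx (by simp [hφ, hηz x hxK])) (isClosed_tsupport _)
  have hφc : HasCompactSupport φ := hη.2.1.of_isClosed_subset (isClosed_tsupport _) hts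
  have hI := heq.integral_difference hγ0 hw hg.continuous hN2 hφc
    ((Metric.cthickening_subset_of_subset δ hts).trans hδU) hh
  set X := fun x => V (x + h) - V x with hX
  have hXm : Measurable X := (hVm.comp (measurable_add_const h)).sub hVm
  have hXb : ∀ x, ‖X x‖ ≤ profile γ C + profile γ C := fun x =>
    (norm_sub_le _ _).trans (add_le_add (hVb _) (hVb _))
  have hηm : Measurable η := hη.1.continuous.measurable
  have i1 : Integrable (fun x => (2 * c)⁻¹ * (η x ^ 2 * ‖X x‖ ^ 2)) volume := by
    refine Integrable.const_mul (integrable_of_bounded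
      (B := 1 * (profile γ C + profile γ C) ^ 2) (K := K) ?_ (fun x => ?_) hη.2.1
      (fun x hx => by simp [hηz x hx])) _
    · exact ((hηm.pow_const 2).mul (hXm.norm.pow_const 2)).aestronglyMeasurable
    · rw [norm_mul, norm_pow, norm_pow, norm_norm]
      exact mul_le_mul (pow_le_one₀ (norm_nonneg _) (hηb x))
        (pow_le_pow_left₀ (norm_nonneg _) (hXb x) 2) (by positivity) zero_le_one
  have i2 : Integrable (K.indicator fun _ => 2 * c * (N : ℝ) ^ 2 * (C * ‖h‖) ^ 2) volume :=
    (integrable_indicator_iff (isClosed_tsupport η).measurableSet).2 (integrableOn_const hKfin)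
  have i3 : Integrable (fun x => inner ℝ (X x) (gradient φ x)) volume :=
    integrable_of_bounded (B := (profile γ C + profile γ C) * N2) (K := K)
      (hXm.inner (measurable_gradient φ)).aestronglyMeasurable
      (fun x => (norm_inner_le_norm _ _).trans (mul_le_mul (hXb x)
        (norm_gradient_le hN2 x) (norm_nonneg _) (by positivity))) hη.2.1
      (fun x hx => by
        rw [gradient_eq_zero_of_notMem_tsupport fun h => hx (hts h), inner_zero_right])
  have i4 : Integrable (K.indicator fun _ => (D * ‖h‖) * (C * ‖h‖)) volume :=
    (integrable_indicator_iff (isClosed_tsupport η).measurableSet).2 (integrableOn_const hKfin)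
  have hwd : ∀ᵐ x, DifferentiableAt ℝ w (x + h) :=
    (measurePreserving_add_right volume h).quasiMeasurePreserving.ae hw.ae_differentiableAt
  have hlow : ∀ᵐ x, (2 * c)⁻¹ * (η x ^ 2 * ‖X x‖ ^ 2) -
      K.indicator (fun _ => 2 * c * (N : ℝ) ^ 2 * (C * ‖h‖) ^ 2) x ≤
      inner ℝ (X x) (gradient φ x) := by
    filter_upwards [hw.ae_differentiableAt, hwd] with x hx hxh
    by_cases hxK : x ∈ K
    · rw [Set.indicator_of_mem hxK]
      have hηd : DifferentiableAt ℝ η x := hη.1.differentiable (by simp) x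
      have hxh' : DifferentiableAt ℝ (fun y => w (y + h)) x := by
        rwa [differentiableAt_comp_add_right]
      refine difference_quotient_pointwise (Y := gradient w (x + h) - gradient w x) hc
        (hcoc _ _ (norm_gradient_le hw _) (norm_gradient_le hw _)) (norm_gradient_le hN x)
        (hwh x) ?_
      rw [hφ, gradient_mul (f := fun y => η y * η y) (g := fun y => w (y + h) - w y)
        (hηd.mul hηd) (hxh'.sub hx), gradient_sub hxh' hx,
        gradient_comp_add_right, gradient_mul hηd hηd]
    · rw [Set.indicator_of_notMem hxK,
        gradient_eq_zero_of_notMem_tsupport fun h => hxK (hts h), (hηz x hxK).1]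
      simp
  have hupp : ∀ x, (g (x + h) - g x) * φ x ≤ K.indicator (fun _ => (D * ‖h‖) * (C * ‖h‖)) x := by
    intro x
    by_cases hxK : x ∈ K
    · rw [Set.indicator_of_mem hxK]
      refine (le_abs_self _).trans ?_
      rw [abs_mul]
      refine mul_le_mul (hgh x) ?_ (abs_nonneg _) (by positivity)
      rw [hφ, abs_mul]
      exact (mul_le_mul (hηη x) (hwh x) (abs_nonneg _) zero_le_one).trans (one_mul _).le
    · simp [hxK, hφ, hηz x hxK]
  have i5 : Integrable (fun x => (g (x + h) - g x) * φ x) volume :=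
    (((hg.continuous.comp (continuous_add_const h)).sub hg.continuous).mul
      hN2.continuous).integrable_of_hasCompactSupport hφc.mul_left
  have j1 := integral_mono_ae (i1.sub i2) i3 hlow
  have j2 := integral_mono i5 i4 hupp
  rw [integral_sub' i1 i2, integral_indicator (isClosed_tsupport η).measurableSet,
    setIntegral_const, integral_const_mul] at j1
  rw [integral_indicator (isClosed_tsupport η).measurableSet, setIntegral_const] at j2
  have j3 : ∫ x in A, ‖X x‖ ^ 2 ≤ ∫ x, η x ^ 2 * ‖X x‖ ^ 2 := by
    have i6 : Integrable (fun x => η x ^ 2 * ‖X x‖ ^ 2) volume :=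
      (integrable_const_mul_iff (IsUnit.mk0 _ (by positivity)) _).1 i1
    rw [setIntegral_congr_fun hA.measurableSet (g := fun x => η x ^ 2 * ‖X x‖ ^ 2) fun x hx => by
      simp [hη1.self_of_nhdsSet x hx]]
    exact setIntegral_le_integral i6 (Eventually.of_forall fun x => by positivity)
  have j4 : (2 * c)⁻¹ * ∫ x, η x ^ 2 * ‖X x‖ ^ 2 ≤
      (D * C + 2 * c * N ^ 2 * C ^ 2) * m * ‖h‖ ^ 2 := by
    simp only [smul_eq_mul] at j1 j2
    rw [← hm] at j1 j2
    change _ ≤ ∫ x, inner ℝ (X x) (gradient φ x) at j1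
    change ∫ x, inner ℝ (X x) (gradient φ x) = _ at hI
    linarith
  rw [inv_mul_le_iff₀ (by positivity)] at j4
  linarith

/-! ### Lower bound on the field from a positive right-hand side -/

/-- The cone of height and radius `r` with centre `z`. -/
noncomputable def cone (r : ℝ) (z x : E n) : ℝ := max (r - ‖x - z‖) 0

lemma cone_nonneg (r : ℝ) (z x : E n) : 0 ≤ cone r z x := le_max_right _ _

lemma cone_eq_zero {r : ℝ} {z x : E n} (hx : x ∉ Metric.closedBall z r) : cone r z x = 0 := by
  rw [Metric.mem_closedBall, dist_eq_norm, not_le] at hx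
  exact max_eq_right (by linarith)

lemma lipschitzWith_cone (r : ℝ) (z : E n) : LipschitzWith 1 (cone r z) := by
  refine LipschitzWith.of_dist_le_mul fun x y => ?_
  rw [NNReal.coe_one, one_mul, Real.dist_eq, cone, cone]
  refine (abs_max_sub_max_le_abs _ _ _).trans ?_
  rw [sub_sub_sub_cancel_left, dist_comm, dist_eq_norm]
  exact (abs_norm_sub_norm_le _ _).trans (by rw [sub_sub_sub_cancel_right])

lemma tsupport_cone_subset (r : ℝ) (z : E n) : tsupport (cone r z) ⊆ Metric.closedBall z r :=
  closure_minimal (fun _ hx => by_contra fun h => hx (cone_eq_zero h)) Metric.isClosed_closedBall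

lemma hasCompactSupport_cone (r : ℝ) (z : E n) : HasCompactSupport (cone r z) :=
  (isCompact_closedBall z r).of_isClosed_subset (isClosed_tsupport _) (tsupport_cone_subset r z)

lemma volume_real_closedBall (z : E n) {r : ℝ} (hr : 0 ≤ r) :
    volume.real (Metric.closedBall z r) = r ^ n * volume.real (Metric.ball (0 : E n) 1) := by
  rw [measureReal_def, Measure.addHaar_closedBall volume z hr, ENNReal.toReal_mul,
    ENNReal.toReal_ofReal (by positivity), measureReal_def]
  simp

/-- On the concentric ball of half the radius the cone is at least r / 2, and that ball has 2⁻ⁿ of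
the volume. -/
lemma le_integral_cone (z : E n) {r : ℝ} (hr : 0 ≤ r) :
    r * 2⁻¹ ^ (n + 1) * volume.real (Metric.closedBall z r) ≤ ∫ x, cone r z x := by
  have hi : Integrable (cone r z) volume :=
    (lipschitzWith_cone r z).continuous.integrable_of_hasCompactSupport (hasCompactSupport_cone r z)
  have h1 : ∫ _ in Metric.closedBall z (r / 2), r / 2 ≤
      ∫ x in Metric.closedBall z (r / 2), cone r z x := by
    refine setIntegral_mono_on (integrableOn_const measure_closedBall_lt_top.ne) hi.integrableOn
      measurableSet_closedBall fun x hx => ?_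
    rw [Metric.mem_closedBall, dist_eq_norm] at hx
    exact le_max_of_le_left (by linarith)
  have h2 := setIntegral_le_integral (s := Metric.closedBall z (r / 2)) hi
    (Eventually.of_forall (cone_nonneg r z))
  rw [setIntegral_const, volume_real_closedBall z (by linarith), smul_eq_mul] at h1
  rw [volume_real_closedBall z hr]
  refine le_trans (le_of_eq ?_) (h1.trans h2)
  rw [div_eq_mul_inv, mul_pow]
  ring

/-- The cone has slope at most 1, so testing with it bounds the integral of g times the cone by that
of ‖H(Dw)‖ over the ball. The domain is centred at the origin so that the integral can later be
exchanged with one over z. -/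
lemma WeakEquation.le_integral_norm {γ : ℝ} (hγ : 0 < γ) {w g : E n → ℝ} {U : Set (E n)}
    (heq : WeakEquation γ w g U) {C : NNReal} (hw : LipschitzWith C w) (hg : Continuous g)
    {z : E n} {r c : ℝ} (hr : 0 ≤ r) (hc : 0 ≤ c) (hzU : Metric.closedBall z r ⊆ U)
    (hgc : ∀ x ∈ Metric.closedBall z r, c ≤ g x) :
    c * (r * 2⁻¹ ^ (n + 1) * volume.real (Metric.closedBall (0 : E n) r)) ≤
      ∫ y in Metric.closedBall (0 : E n) r, ‖H γ (gradient w (z + y))‖ := by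
  have hlip := lipschitzWith_cone r z
  have hcs := hasCompactSupport_cone r z
  have hts := tsupport_cone_subset r z
  have e := heq 1 (cone r z) hlip hcs (hts.trans hzU)
  have h1 : c * ∫ x, cone r z x ≤ ∫ x, g x * cone r z x := by
    rw [← integral_const_mul]
    refine integral_mono ((hlip.continuous.integrable_of_hasCompactSupport hcs).const_mul c)
      ((hg.mul hlip.continuous).integrable_of_hasCompactSupport hcs.mul_left) fun x => ?_
    by_cases hx : x ∈ Metric.closedBall z r
    · exact mul_le_mul_of_nonneg_right (hgc x hx) (cone_nonneg r z x)
    · simp [cone_eq_zero hx]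
  have hV := measurable_H_gradient γ w
  have h2 : ∫ x, inner ℝ (H γ (gradient w x)) (gradient (cone r z) x) ≤
      ∫ x in Metric.closedBall z r, ‖H γ (gradient w x)‖ := by
    rw [← integral_indicator measurableSet_closedBall]
    refine integral_mono ?_ ?_ fun x => ?_
    · refine integrable_of_bounded (B := profile γ C * 1)
        (hV.inner (measurable_gradient _)).aestronglyMeasurable
        (fun x => (norm_inner_le_norm _ _).trans (mul_le_mul (norm_H_gradient_le hγ hw _)
          (norm_gradient_le hlip x) (norm_nonneg _) (profile_nonneg _ _))) hcs
        (fun x hx => by rw [gradient_eq_zero_of_notMem_tsupport hx, inner_zero_right])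
    · rw [integrable_indicator_iff measurableSet_closedBall]
      exact Measure.integrableOn_of_bounded (M := profile γ C) measure_closedBall_lt_top.ne
        hV.norm.aestronglyMeasurable
        (Eventually.of_forall fun x => by rw [norm_norm]; exact norm_H_gradient_le hγ hw x)
    · by_cases hx : x ∈ Metric.closedBall z r
      · rw [Set.indicator_of_mem hx]
        refine (real_inner_le_norm _ _).trans ?_
        have := norm_gradient_le hlip x
        exact mul_le_of_le_one_right (norm_nonneg _) (by simpa using this)
      · rw [Set.indicator_of_notMem hx,
          gradient_eq_zero_of_notMem_tsupport fun h => hx (hts h), inner_zero_right]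
  have h3 : ∫ x in Metric.closedBall z r, ‖H γ (gradient w x)‖ =
      ∫ y in Metric.closedBall (0 : E n) r, ‖H γ (gradient w (z + y))‖ := by
    rw [← integral_indicator measurableSet_closedBall, ← integral_add_left_eq_self _ z,
      ← integral_indicator measurableSet_closedBall]
    refine integral_congr_ae (Eventually.of_forall fun y => ?_)
    have hiff : z + y ∈ Metric.closedBall z r ↔ y ∈ Metric.closedBall (0 : E n) r := by
      simp [Metric.mem_closedBall, dist_eq_norm]
    by_cases hy : y ∈ Metric.closedBall (0 : E n) r
    · simp only [Set.indicator_of_mem hy, Set.indicator_of_mem (hiff.2 hy)]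
    · simp only [Set.indicator_of_notMem hy, Set.indicator_of_notMem fun h => hy (hiff.1 h)]
  have h4 : volume.real (Metric.closedBall (0 : E n) r) = volume.real (Metric.closedBall z r) := by
    rw [volume_real_closedBall _ hr, volume_real_closedBall _ hr]
  rw [h4, ← h3]
  refine le_trans ?_ h2
  rw [e]
  exact (mul_le_mul_of_nonneg_left (le_integral_cone z hr) hc).trans h1

/-! ### H(Dw) vanishes almost nowhere -/

/-- A bounded field vanishing on a compact set `A`, with `L²` bounds on its difference quotients,
is small on the translates of `A`. -/
lemma setIntegral_norm_translate_le {V : E n → E n} (hV : Measurable V) {B : ℝ}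
    (hB : ∀ x, ‖V x‖ ≤ B) {A : Set (E n)} (hA : IsCompact A) (hA0 : ∀ x ∈ A, V x = 0)
    {M r κ : ℝ} (hM : 0 ≤ M) (hr : 0 < r) (hκ : 0 < κ) {y : E n} (hy : ‖y‖ ≤ r)
    (hMy : ∫ x in A, ‖V (x + y) - V x‖ ^ 2 ≤ M * ‖y‖ ^ 2) :
    ∫ x in A, ‖V (x + y)‖ ≤
      r * (κ * M + κ⁻¹ * volume.real (Metric.cthickening r A \ A)) := by
  set S := Metric.cthickening r A \ A with hS
  have hSm : MeasurableSet S := Metric.isClosed_cthickening.measurableSet.diff hA.measurableSet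
  have hSfin : volume S ≠ ⊤ :=
    ((measure_mono Set.sdiff_subset).trans_lt (IsCompact.cthickening hA).measure_lt_top).ne
  have hVy : Measurable (fun x => V (x + y)) := hV.comp (measurable_add_const y)
  have hB0 : 0 ≤ B := (norm_nonneg _).trans (hB 0)
  have iS : Integrable (S.indicator fun _ => (1 : ℝ)) volume :=
    (integrable_indicator_iff hSm).2 (integrableOn_const hSfin)
  have iSy : Integrable (fun x => S.indicator (fun _ => (1 : ℝ)) (x + y)) volume :=
    iS.comp_add_right y
  have i1 : IntegrableOn (fun x => ‖V (x + y)‖) A volume :=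
    Measure.integrableOn_of_bounded (M := B) hA.measure_lt_top.ne hVy.norm.aestronglyMeasurable
      (Eventually.of_forall fun x => by rw [norm_norm]; exact hB _)
  have i2 : IntegrableOn (fun x => ‖V (x + y) - V x‖ ^ 2) A volume :=
    Measure.integrableOn_of_bounded (M := (B + B) ^ 2) hA.measure_lt_top.ne
      ((hVy.sub hV).norm.pow_const 2).aestronglyMeasurable
      (Eventually.of_forall fun x => by
        rw [norm_pow, norm_norm]
        exact pow_le_pow_left₀ (norm_nonneg _)
          ((norm_sub_le _ _).trans (add_le_add (hB _) (hB _))) 2)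
  -- Either x + y stays in A, where V vanishes, or it lies in the shell S. There V(x + y) is an
  -- increment, as V(x) = 0, and Young's inequality with weight κ / r applies; this weight makes
  -- both terms proportional to r after integration.
  have hpt : ∀ x ∈ A, ‖V (x + y)‖ ≤ κ / r * ‖V (x + y) - V x‖ ^ 2 +
      r / κ * S.indicator (fun _ => (1 : ℝ)) (x + y) := by
    intro x hx
    by_cases hxy : x + y ∈ A
    · rw [hA0 _ hxy, norm_zero]
      have : 0 ≤ S.indicator (fun _ => (1 : ℝ)) (x + y) :=
        Set.indicator_nonneg (fun _ _ => zero_le_one) _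
      positivity
    · have hxS : x + y ∈ S := ⟨Metric.mem_cthickening_of_dist_le _ x _ _ hx
        (by rwa [dist_eq_norm, add_sub_cancel_left]), hxy⟩
      rw [Set.indicator_of_mem hxS, hA0 x hx, sub_zero, mul_one]
      set a := ‖V (x + y)‖
      have h1 : 0 ≤ (κ / r) * (a - r / κ) ^ 2 + a := by positivity
      have h2 : (κ / r) * (a - r / κ) ^ 2 = κ / r * a ^ 2 + r / κ - 2 * a := by
        field_simp
        ring
      linarith
  have hi := setIntegral_mono_on i1 ((i2.const_mul (κ / r)).add
    (iSy.integrableOn.const_mul (r / κ))) hA.measurableSet hpt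
  rw [integral_add' (i2.const_mul _) (iSy.integrableOn.const_mul _), integral_const_mul,
    integral_const_mul] at hi
  have hSy : ∫ x in A, S.indicator (fun _ => (1 : ℝ)) (x + y) ≤ volume.real S := by
    refine (setIntegral_le_integral iSy (Eventually.of_forall fun x =>
      Set.indicator_nonneg (fun _ _ => zero_le_one) _)).trans (le_of_eq ?_)
    rw [integral_add_right_eq_self (S.indicator fun _ => (1 : ℝ)) y, integral_indicator hSm]
    simp
  have hMr : M * ‖y‖ ^ 2 ≤ M * r ^ 2 := by gcongr
  calc _ ≤ _ := hi
    _ ≤ κ / r * (M * r ^ 2) + r / κ * volume.real S := by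
      gcongr
      exact hMy.trans hMr
    _ = _ := by
      field_simp

/-- Where the right-hand side is positive, the field `H(Dw)` vanishes on a null set only. -/
theorem WeakEquation.ae_H_ne_zero {γ : ℝ} (hγ : 1 ≤ γ) {w g : E n → ℝ} {U : Set (E n)}
    (hU : IsOpen U) (heq : WeakEquation γ w g U) {C D : NNReal} (hw : LipschitzWith C w)
    (hg : LipschitzWith D g) (hpos : ∀ x ∈ U, 0 < g x) :
    ∀ᵐ x ∂volume.restrict U, H γ (gradient w x) ≠ 0 := by
  have hγ0 : 0 < γ := by linarith
  set V := fun x => H γ (gradient w x) with hVdef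
  have hV : Measurable V := measurable_H_gradient γ w
  have hVb : ∀ x, ‖V x‖ ≤ profile γ C := norm_H_gradient_le hγ0 hw
  have hZm : MeasurableSet (U ∩ V ⁻¹' {0}) :=
    hU.measurableSet.inter (hV (measurableSet_singleton 0))
  rw [ae_restrict_iff' hU.measurableSet, ae_iff]
  have hset : {x | ¬(x ∈ U → H γ (gradient w x) ≠ 0)} = U ∩ V ⁻¹' {0} := by
    ext x
    simp [V]
  rw [hset]
  by_contra hne
  obtain ⟨A, hAZ, hA, hApos⟩ := hZm.exists_lt_isCompact (μ := volume) (pos_iff_ne_zero.2 hne)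
  have hAU : A ⊆ U := hAZ.trans Set.inter_subset_left
  have hA0 : ∀ x ∈ A, V x = 0 := fun x hx => (hAZ hx).2
  have hAr : 0 < volume.real A := ENNReal.toReal_pos hApos.ne' hA.measure_lt_top.ne
  have hAne : A.Nonempty := nonempty_of_measure_ne_zero hApos.ne'
  obtain ⟨M, hM0, δ₁, hδ₁, hM⟩ := heq.difference_quotient hγ hU hw hg hA hAU
  obtain ⟨δ₀, hδ₀, hδU⟩ := hA.exists_cthickening_subset_open hU hAU
  -- The minimum of g over a compact neighbourhood of A in U is a positive lower bound valid on all
  -- the balls used below.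
  obtain ⟨x₀, hx₀, hmin⟩ := (IsCompact.cthickening (r := δ₀) hA).exists_isMinOn
    (hAne.mono (Metric.self_subset_cthickening A)) hg.continuous.continuousOn
  set c := g x₀ with hc
  have hcpos : 0 < c := hpos _ (hδU hx₀)
  -- The cone bound is integrated over z ∈ A, the integrals are exchanged, and the translate bound
  -- is applied for each y; the common factor b * r cancels.
  have key : ∀ r κ : ℝ, 0 < r → r ≤ δ₀ → r ≤ δ₁ → 0 < κ → c * 2⁻¹ ^ (n + 1) * volume.real A ≤
      κ * M + κ⁻¹ * volume.real (Metric.cthickening r A \ A) := by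
    intro r κ hr hr0 hr1 hκ
    set b := volume.real (Metric.closedBall (0 : E n) r) with hb
    have hbpos : 0 < b := ENNReal.toReal_pos
      (Metric.measure_closedBall_pos volume 0 hr).ne' measure_closedBall_lt_top.ne
    have : IsFiniteMeasure (volume.restrict A) := isFiniteMeasure_restrict.2 hA.measure_lt_top.ne
    have : IsFiniteMeasure (volume.restrict (Metric.closedBall (0 : E n) r)) :=
      isFiniteMeasure_restrict.2 measure_closedBall_lt_top.ne
    have hint : Integrable (Function.uncurry fun z y : E n => ‖V (z + y)‖)
        ((volume.restrict A).prod (volume.restrict (Metric.closedBall (0 : E n) r))) := by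
      refine Integrable.of_bound (hV.comp measurable_add).norm.aestronglyMeasurable (profile γ C)
        (Eventually.of_forall fun q => ?_)
      rw [Function.uncurry, norm_norm]
      exact hVb _
    have h1 : ∫ _ in A, c * (r * 2⁻¹ ^ (n + 1) * b) ≤
        ∫ z in A, ∫ y in Metric.closedBall (0 : E n) r, ‖V (z + y)‖ := by
      refine setIntegral_mono_on (integrableOn_const hA.measure_lt_top.ne)
        hint.integral_prod_left hA.measurableSet fun z hz => ?_
      have hzr : Metric.closedBall z r ⊆ Metric.cthickening δ₀ A :=
        (Metric.closedBall_subset_cthickening hz r).trans (Metric.cthickening_mono hr0 A)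
      exact heq.le_integral_norm hγ0 hw hg.continuous hr.le hcpos.le (hzr.trans hδU)
        fun x hx => hmin (hzr hx)
    rw [integral_integral_swap hint] at h1
    have h2 : ∫ y in Metric.closedBall (0 : E n) r, ∫ z in A, ‖V (z + y)‖ ≤
        ∫ _ in Metric.closedBall (0 : E n) r,
          r * (κ * M + κ⁻¹ * volume.real (Metric.cthickening r A \ A)) := by
      refine setIntegral_mono_on hint.integral_prod_right
        (integrableOn_const measure_closedBall_lt_top.ne) measurableSet_closedBall fun y hy => ?_
      have hy' : ‖y‖ ≤ r := mem_closedBall_zero_iff.1 hy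
      exact setIntegral_norm_translate_le hV hVb hA hA0 hM0 hr hκ hy' (hM y (hy'.trans hr1))
    rw [setIntegral_const, smul_eq_mul] at h1 h2
    have h3 : (b * r) * (c * 2⁻¹ ^ (n + 1) * volume.real A) ≤
        (b * r) * (κ * M + κ⁻¹ * volume.real (Metric.cthickening r A \ A)) := by
      linarith [h1.trans h2]
    exact le_of_mul_le_mul_left h3 (by positivity)
  have hlim : Tendsto (fun r => volume.real (Metric.cthickening r A \ A)) (𝓝[>] 0) (𝓝 0) := by
    have h1 : Tendsto (fun r => volume (Metric.cthickening r A \ A)) (𝓝[>] 0) (𝓝 0) := by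
      have h2 := (tendsto_measure_cthickening_of_isCompact (μ := volume) hA).mono_left
        (nhdsWithin_le_nhds (s := Set.Ioi 0))
      have h3 := ENNReal.Tendsto.sub h2 (tendsto_const_nhds (x := volume A))
        (.inl hA.measure_lt_top.ne)
      rw [tsub_self] at h3
      refine h3.congr fun r => ?_
      rw [measure_sdiff (Metric.self_subset_cthickening A) hA.measurableSet.nullMeasurableSet
        hA.measure_lt_top.ne]
    have h4 := (ENNReal.tendsto_toReal ENNReal.zero_ne_top).comp h1
    rwa [ENNReal.toReal_zero] at h4
  -- With κ fixed, r tends to 0 and removes the shell term; only then is κ chosen small.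
  have key2 : ∀ κ : ℝ, 0 < κ → c * 2⁻¹ ^ (n + 1) * volume.real A ≤ κ * M := by
    intro κ hκ
    have h1 := (hlim.const_mul κ⁻¹).const_add (κ * M)
    rw [mul_zero, add_zero] at h1
    refine ge_of_tendsto h1 ?_
    filter_upwards [Ioo_mem_nhdsGT (lt_min hδ₀ hδ₁)] with r hr
    exact key r κ hr.1 (hr.2.le.trans (min_le_left _ _)) (hr.2.le.trans (min_le_right _ _)) hκ
  have hq : 0 < c * 2⁻¹ ^ (n + 1) * volume.real A := by positivity
  have h1 := key2 (c * 2⁻¹ ^ (n + 1) * volume.real A / (2 * (M + 1))) (by positivity)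
  rw [div_mul_eq_mul_div, le_div_iff₀ (by positivity)] at h1
  nlinarith

/-! ### Reduction to globally Lipschitz data -/

/-- Locally, a solution satisfies the equation for globally Lipschitz data. -/
theorem IsLocalWeakSolution.exists_weakEquation {p : ℝ} (hp : 2 ≤ p) {Ω : Set (E n)}
    (hΩ : IsOpen Ω) {f : E n → ℝ → ℝ} (hf : LocallyLipschitzRHS Ω f) {u : E n → ℝ}
    {Du : E n → E n} (hu : ContinuousOn u Ω) (hW : MemW1Loc ⊤ Ω u Du)
    (hsol : IsLocalWeakSolution p f Ω u Du) {V : Set (E n)} (hV : IsOpen V)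
    (hVΩ : CompactlyContained V Ω) :
    ∃ (C D : NNReal) (w g : E n → ℝ), LipschitzWith C w ∧ (∃ B, ∀ x, ‖w x‖ ≤ B) ∧
      LipschitzWith D g ∧ Set.EqOn w u V ∧ (∀ x ∈ V, g x = f x (u x)) ∧
      WeakEquation (p - 1) w g V := by
  obtain ⟨C, w, hw, hwb, hwu, hDw⟩ := exists_lipschitz_extension hΩ hu hW hV hVΩ
  obtain ⟨K, hK⟩ := hVΩ.1.exists_bound_of_continuousOn (hu.mono hVΩ.2)
  have hK' : ∀ x ∈ V, |u x| ≤ max K 1 := fun x hx =>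
    (hK x (subset_closure hx)).trans (le_max_left _ _)
  obtain ⟨L, M, hL, hM, h1, h2⟩ := hf V hV hVΩ (max K 1) (by positivity)
  -- On V the right-hand side is Lipschitz in x alone, through f and through u, and therefore
  -- extends to a Lipschitz function g on the whole space.
  have hlip : LipschitzOnWith ⟨L * C + M, by positivity⟩ (fun x => f x (u x)) V := by
    refine LipschitzOnWith.of_dist_le_mul fun x hx y hy => ?_
    have e1 := h1 x hx (u x) (u y) (hK' x hx) (hK' y hy)
    have e2 := h2 x hx y hy (u y) (hK' y hy)
    have e3 := hw.dist_le_mul x y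
    rw [hwu hx, hwu hy, Real.dist_eq] at e3
    rw [← dist_eq_norm] at e2
    rw [Real.dist_eq]
    change _ ≤ (L * C + M) * dist x y
    calc |f x (u x) - f y (u y)|
        ≤ |f x (u x) - f x (u y)| + |f x (u y) - f y (u y)| := abs_sub_le _ _ _
      _ ≤ L * (C * dist x y) + M * dist x y :=
        add_le_add (e1.trans (mul_le_mul_of_nonneg_left e3 hL.le)) e2
      _ = _ := by ring
  obtain ⟨g, hg, hgf⟩ := hlip.extend_real
  refine ⟨C, _, w, g, hw, hwb, hg, hwu, fun x hx => (hgf hx).symm, fun N φ hφ hc hs => ?_⟩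
  have hp0 : ENNReal.ofReal p ≠ 0 := (ENNReal.ofReal_pos.2 (by linarith)).ne'
  have e := (hsol.2 V hV hVΩ φ (gradient φ)
    (memW1Zero_of_lipschitz hp0 ENNReal.ofReal_ne_top hV hφ hc hs)).2.2
  rw [← setIntegral_eq_of_tsupport hs (fun x hx => by
      rw [gradient_eq_zero_of_notMem_tsupport hx, inner_zero_right]),
    ← setIntegral_eq_of_tsupport (g := fun x => g x * φ x) hs (fun x hx => by
      rw [image_eq_zero_of_notMem_tsupport hx, mul_zero])]
  calc _ = ∫ x in V, inner ℝ (H (p - 1) (Du x)) (gradient φ x) := by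
        refine integral_congr_ae ?_
        filter_upwards [hDw] with x hx
        rw [hx]
    _ = ∫ x in V, f x (u x) * φ x := e
    _ = _ := setIntegral_congr_fun hV.measurableSet fun x hx => by
        rw [← hgf hx]

/-! ### Comparison by truncation -/

lemma gradient_eq_zero_of_isLocalMin {f : E n → ℝ} {x : E n} (h : IsLocalMin f x) :
    gradient f x = 0 := by
  rw [gradient, h.fderiv_eq_zero, map_zero]

/-- Integrating by parts against the linear function ⟨e, x⟩, whose derivative along e is 1, shows
that φ has integral zero; it is continuous and nonnegative. -/
lemma eq_zero_of_gradient_eq_zero (hn : 0 < n) {φ : E n → ℝ} {C : NNReal}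
    (hφ : LipschitzWith C φ) (hc : HasCompactSupport φ) (h0 : ∀ x, 0 ≤ φ x)
    (hg : ∀ᵐ x, gradient φ x = 0) (x : E n) : φ x = 0 := by
  set e : E n := EuclideanSpace.single ⟨0, hn⟩ 1 with he
  have hee : inner ℝ e e = 1 := by simp [he]
  have hl : LipschitzWith ‖innerSL ℝ e‖₊ (fun x => inner ℝ e x) := (innerSL ℝ e).lipschitz
  have hlg : ∀ x, inner ℝ (gradient (fun x => inner ℝ e x) x) e = 1 := fun x => by
    rw [inner_gradient_left]
    exact (congrArg (· e) (innerSL ℝ e).fderiv).trans hee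
  have h1 := integral_mul_inner_gradient hl hφ hc e
  simp only [hlg, mul_one] at h1
  rw [integral_eq_zero_of_ae (by
    filter_upwards [hg] with x hx
    simp [hx])] at h1
  have hi : Integrable φ volume := hφ.continuous.integrable_of_hasCompactSupport hc
  have h2 := (integral_eq_zero_iff_of_nonneg h0 hi).1 (neg_eq_zero.1 h1.symm)
  exact congrFun ((hφ.continuous.ae_eq_iff_eq volume continuous_const).1 h2) x

/-- The truncated difference of two solutions has vanishing gradient. -/
lemma WeakEquation.gradient_truncation_eq_zero {γ : ℝ} (hγ : 1 ≤ γ) {V : Set (E n)}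
    (hV : IsOpen V) {wu wv gu gv φ : E n → ℝ} {C C' D D' N : NNReal}
    (hwu : LipschitzWith C wu) (hwv : LipschitzWith C' wv) (hgu : LipschitzWith D gu)
    (hgv : LipschitzWith D' gv) (hu : WeakEquation γ wu gu V) (hv : WeakEquation γ wv gv V)
    (hpos : ∀ x ∈ V, 0 < gu x) (hφ : LipschitzWith N φ) (hc : HasCompactSupport φ)
    (hs : tsupport φ ⊆ V) (h0 : ∀ x, 0 ≤ φ x) (hle : ∀ x, 0 < φ x → gu x ≤ gv x)
    (hgrad : ∀ᵐ x, 0 < φ x → gradient φ x = gradient wu x - gradient wv x) :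
    ∀ᵐ x, gradient φ x = 0 := by
  have hγ0 : 0 < γ := by linarith
  obtain ⟨c, hc0, hcoc⟩ := H_cocoercive (n := n) hγ (max C C')
  have hcoc' := fun x => hcoc (gradient wu x) (gradient wv x)
    ((norm_gradient_le hwu x).trans (le_max_left _ _))
    ((norm_gradient_le hwv x).trans (le_max_right _ _))
  -- Where φ is not positive it attains its minimum 0, so the gradient is 0; at points of
  -- nondifferentiability this is the default value.
  have hmin : ∀ x, ¬ 0 < φ x → gradient φ x = 0 := fun x hx =>
    gradient_eq_zero_of_isLocalMin (Eventually.of_forall fun y =>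
      (not_lt.1 hx).trans (h0 y))
  have hint : ∀ {w : E n → ℝ} {C : NNReal}, LipschitzWith C w → Integrable
      (fun x => inner ℝ (H γ (gradient w x)) (gradient φ x)) volume := fun {w C} hw =>
    integrable_of_bounded (B := profile γ C * N) (K := tsupport φ)
      ((measurable_H_gradient γ w).inner (measurable_gradient φ)).aestronglyMeasurable
      (fun x => (norm_inner_le_norm _ _).trans (mul_le_mul (norm_H_gradient_le hγ0 hw _)
        (norm_gradient_le hφ x) (norm_nonneg _) (profile_nonneg _ _))) hc
      (fun x hx => by rw [gradient_eq_zero_of_notMem_tsupport hx, inner_zero_right])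
  have hint' : ∀ {g : E n → ℝ} {D : NNReal}, LipschitzWith D g →
      Integrable (fun x => g x * φ x) volume := fun hg =>
    (hg.continuous.mul hφ.continuous).integrable_of_hasCompactSupport hc.mul_left
  set F := fun x => inner ℝ (H γ (gradient wu x) - H γ (gradient wv x)) (gradient φ x) with hF
  have hFi : Integrable F volume := by
    simp only [hF, inner_sub_left]
    exact (hint hwu).sub (hint hwv)
  have hF0 : 0 ≤ᵐ[volume] F := by
    filter_upwards [hgrad] with x hx
    by_cases hφx : 0 < φ x
    · simp only [hF, hx hφx, Pi.zero_apply]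
      exact nonneg_of_mul_nonneg_right ((sq_nonneg _).trans (hcoc' x)) hc0
    · simp only [hF, hmin x hφx, inner_zero_right, Pi.zero_apply, le_refl]
  -- Subtracting the equations leaves gu - gv, which is nonpositive where φ > 0. With F ≥ 0 this
  -- forces F = 0 almost everywhere.
  have hFle : ∫ x, F x ≤ 0 := by
    have e : ∫ x, F x = ∫ x, (gu x - gv x) * φ x := by
      simp only [hF, inner_sub_left, sub_mul]
      rw [integral_sub (hint hwu) (hint hwv), integral_sub (hint' hgu) (hint' hgv),
        hu N φ hφ hc hs, hv N φ hφ hc hs]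
    rw [e]
    refine integral_nonpos fun x => ?_
    rcases (h0 x).eq_or_lt with h | h
    · simp [← h]
    · exact mul_nonpos_of_nonpos_of_nonneg (sub_nonpos.2 (hle x h)) h.le
  have hF1 := (integral_eq_zero_iff_of_nonneg_ae hF0 hFi).1
    (le_antisymm hFle (integral_nonneg_of_ae hF0))
  filter_upwards [hF1, hgrad, (ae_restrict_iff' hV.measurableSet).1
    (hu.ae_H_ne_zero hγ hV hwu hgu hpos)] with x hx1 hx2 hx3
  by_cases hφx : 0 < φ x
  · have hxV : x ∈ V := hs (subset_tsupport _ hφx.ne')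
    simp only [hF, hx2 hφx, Pi.zero_apply] at hx1
    -- F = 0 and cocoercivity give equal fields; since H(Dwu) ≠ 0 almost everywhere, the gradients
    -- agree too.
    have h4 := hcoc' x
    rw [hx1, mul_zero] at h4
    have h5 : H γ (gradient wu x) = H γ (gradient wv x) :=
      sub_eq_zero.1 (norm_eq_zero.1 (pow_eq_zero_iff two_ne_zero |>.1
        (le_antisymm h4 (sq_nonneg _))))
    rw [hx2 hφx, eq_of_H_eq hγ0 h5 (hx3 hxV), sub_self]
  · exact hmin x hφx

/-- If `{u - v ≥ ε}` is compact in `O`, then `u ≤ v + ε` in `O`. -/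
theorem le_add_of_isCompact (hn : 0 < n) {p : ℝ} (hp : 2 ≤ p) {Ω : Set (E n)} (hΩ : IsOpen Ω)
    {f : E n → ℝ → ℝ} (hfpos : ∀ x ∈ Ω, ∀ s : ℝ, 0 < f x s) (hfLip : LocallyLipschitzRHS Ω f)
    (hfmono : ∀ x ∈ Ω, Antitone (f x)) {u v : E n → ℝ} {Du Dv : E n → E n}
    (hucont : ContinuousOn u Ω) (hvcont : ContinuousOn v Ω)
    (huW : MemW1Loc ⊤ Ω u Du) (hvW : MemW1Loc ⊤ Ω v Dv)
    (hu : IsLocalWeakSolution p f Ω u Du) (hv : IsLocalWeakSolution p f Ω v Dv)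
    {O : Set (E n)} (hO : IsOpen O) (hOΩ : O ⊆ Ω) {ε : ℝ} (hε : 0 < ε)
    (hS : IsCompact {x | x ∈ O ∧ ε ≤ u x - v x}) {x : E n} (hx : x ∈ O) : u x ≤ v x + ε := by
  set S := {x | x ∈ O ∧ ε ≤ u x - v x} with hSdef
  obtain ⟨V, hV, hSV, hVO, hVc⟩ := exists_open_between_and_isCompact_closure hS hO fun _ h => h.1
  have hVΩ : CompactlyContained V Ω := ⟨hVc, hVO.trans hOΩ⟩
  have hVsub : V ⊆ Ω := subset_closure.trans hVΩ.2
  obtain ⟨C, D, wu, gu, hwu, ⟨B, hB⟩, hgu, hwuu, hguf, hequ⟩ :=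
    hu.exists_weakEquation hp hΩ hfLip hucont huW hV hVΩ
  obtain ⟨C', D', wv, gv, hwv, ⟨B', hB'⟩, hgv, hwvv, hgvf, heqv⟩ :=
    hv.exists_weakEquation hp hΩ hfLip hvcont hvW hV hVΩ
  obtain ⟨χ, hχ, hχ1, hχI⟩ := exists_cutoff hS hV hSV
  obtain ⟨N, hN⟩ := hχ.lipschitz
  have hB0 : 0 ≤ B := (norm_nonneg _).trans (hB 0)
  have hB0' : 0 ≤ B' := (norm_nonneg _).trans (hB' 0)
  have hlip : LipschitzWith (C + C' + 0) (fun x => max (wu x - wv x - ε) 0) :=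
    ((hwu.sub hwv).sub (LipschitzWith.const ε)).max_const 0
  have hbd : ∀ x, ‖max (wu x - wv x - ε) 0‖ ≤ B + B' := fun x => by
    rw [Real.norm_of_nonneg (le_max_right _ _)]
    have h1 := (abs_le.1 (hB x)).2
    have h2 := (abs_le.1 (hB' x)).1
    exact max_le (by linarith) (by linarith)
  obtain ⟨N', hφ⟩ := lipschitzWith_mul hN hlip (A := 1) (fun x => by
    rw [Real.norm_of_nonneg (hχI x).1]
    exact (hχI x).2) hbd
  -- The cutoff removes the values of the extensions away from V. Inside V the truncation is
  -- positive only on S, where χ = 1, so χ contributes nothing to the gradient of φ where φ > 0.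
  set φ := fun x => χ x * max (wu x - wv x - ε) 0 with hφdef
  have hφS : ∀ x, φ x ≠ 0 → x ∈ S ∧ 0 < wu x - wv x - ε := fun x hx => by
    have hxV : x ∈ V := hχ.2.2 (subset_tsupport _ (left_ne_zero_of_mul hx))
    have hpos : 0 < wu x - wv x - ε := by
      by_contra h
      exact right_ne_zero_of_mul hx (max_eq_right (not_lt.1 h))
    refine ⟨⟨hVO (subset_closure hxV), ?_⟩, hpos⟩
    rw [← hwuu hxV, ← hwvv hxV]
    linarith
  have hts : tsupport φ ⊆ S := closure_minimal (fun x hx => (hφS x hx).1) hS.isClosed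
  have hc : HasCompactSupport φ := hS.of_isClosed_subset (isClosed_tsupport _) hts
  have h0 : ∀ x, 0 ≤ φ x := fun x => mul_nonneg (hχI x).1 (le_max_right _ _)
  have hgrad : ∀ᵐ x, 0 < φ x → gradient φ x = gradient wu x - gradient wv x := by
    filter_upwards [hwu.ae_differentiableAt, hwv.ae_differentiableAt] with x hxu hxv hx
    obtain ⟨hxS, hxpos⟩ := hφS x hx.ne'
    have hcont : Continuous (fun y => wu y - wv y - ε) :=
      (hwu.continuous.sub hwv.continuous).sub continuous_const
    have heq : φ =ᶠ[𝓝 x] fun y => (wu y - wv y) - ε := by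
      filter_upwards [eventually_nhdsSet_iff_forall.1 hχ1 x hxS,
        continuousAt_const.eventually_lt hcont.continuousAt hxpos] with y hy1 hy2
      simp only [hφdef, hy1, one_mul]
      exact max_eq_left hy2.le
    rw [heq.gradient_eq, gradient_sub (f := fun y => wu y - wv y) (hxu.sub hxv)
      (differentiableAt_const ε), gradient_fun_const,
      sub_zero, gradient_sub hxu hxv]
  have hφ0 := eq_zero_of_gradient_eq_zero hn hφ hc h0
    (hequ.gradient_truncation_eq_zero (by linarith) hV hwu hwv hgu hgv heqv
      (fun x hx => by rw [hguf x hx]; exact hfpos x (hVsub hx) _) hφ hc (hts.trans hSV) h0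
      (fun x hx => by
        obtain ⟨hxS, -⟩ := hφS x hx.ne'
        have hxV := hSV hxS
        rw [hguf x hxV, hgvf x hxV]
        exact hfmono x (hVsub hxV) (by linarith [hxS.2])) hgrad)
  by_contra! hlt
  have hxS : x ∈ S := ⟨hx, by linarith⟩
  have h1 := hφ0 x
  simp only [hφdef, hχ1.self_of_nhdsSet x hxS, one_mul, hwuu (hSV hxS), hwvv (hSV hxS)] at h1
  linarith [le_max_left (u x - v x - ε) 0]

/-! ### Compactness of the superlevel sets of u - v -/

/-- On the frontier u - v ≤ 0 < ε, so the superlevel set equals its relatively closed counterpart in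
the compact closure of O. -/
lemma isCompact_superlevel_of_le_frontier {Ω O : Set (E n)} (hO : CompactlyContained O Ω)
    (hOo : IsOpen O) {u v : E n → ℝ} (hu : ContinuousOn u Ω) (hv : ContinuousOn v Ω)
    (h : ∀ x ∈ frontier O, u x ≤ v x) {ε : ℝ} (hε : 0 < ε) :
    IsCompact {x | x ∈ O ∧ ε ≤ u x - v x} := by
  have hcl : IsClosed (closure O ∩ (fun x => u x - v x) ⁻¹' Set.Ici ε) :=
    ((hu.sub hv).mono hO.2).preimage_isClosed_of_isClosed isClosed_closure isClosed_Ici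
  have hset : {x | x ∈ O ∧ ε ≤ u x - v x} = closure O ∩ (fun x => u x - v x) ⁻¹' Set.Ici ε := by
    ext x
    refine ⟨fun hx => ⟨subset_closure hx.1, hx.2⟩, fun hx => ⟨?_, hx.2⟩⟩
    by_contra hxO
    have h1 := h x (hOo.frontier_eq ▸ ⟨hx.1, hxO⟩)
    have h2 : ε ≤ u x - v x := hx.2
    linarith
  rw [hset]
  exact hO.1.of_isClosed_subset hcl Set.inter_subset_left

/-- The condition at infinity gives boundedness. A limit point on the boundary is impossible, since
u - v ≤ ε / 2 near it within Ω; at limit points inside Ω continuity applies. -/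
lemma LeOnBoundary.isCompact_superlevel {Ω : Set (E n)} (hΩ : IsOpen Ω) {u v : E n → ℝ}
    (hu : ContinuousOn u Ω) (hv : ContinuousOn v Ω) (h : LeOnBoundary Ω u v) {ε : ℝ}
    (hε : 0 < ε) : IsCompact {x | x ∈ Ω ∧ ε ≤ u x - v x} := by
  have hsub : {x | x ∈ Ω ∧ ε ≤ u x - v x} ⊆ Ω := fun _ h => h.1
  refine Metric.isCompact_of_isClosed_isBounded (isClosed_of_closure_subset fun y hy => ?_) ?_
  · have hyΩ : y ∈ closure Ω := closure_mono hsub hy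
    by_cases hyO : y ∈ Ω
    · have := mem_closure_iff_nhdsWithin_neBot.1 hy
      refine ⟨hyO, ge_of_tendsto
        (((hu.sub hv) y hyO).mono_left (nhdsWithin_mono y hsub)) ?_⟩
      filter_upwards [self_mem_nhdsWithin] with x hx using hx.2
    · have h1 := h.1 y (hΩ.frontier_eq ▸ ⟨hyΩ, hyO⟩) (ε / 2) (by positivity)
      have := mem_closure_iff_nhdsWithin_neBot.1 hy
      obtain ⟨x, hx1, hx2⟩ := ((h1.filter_mono (nhdsWithin_mono y hsub)).and
        (self_mem_nhdsWithin (s := {x | x ∈ Ω ∧ ε ≤ u x - v x}))).exists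
      linarith [hx2.2]
  · have h1 := h.2 (ε / 2) (by positivity)
    rw [eventually_inf_principal] at h1
    refine (Bornology.isBounded_def.2 ?_)
    filter_upwards [h1] with x hx hxS
    linarith [hx hxS.1, hxS.2]

end WeakComparison

theorem mainTheorem1 (n : ℕ) (hn : 2 ≤ n) (p : ℝ) (hp : 2 ≤ p)
    (Ω : Set (WeakComparison.E n)) (hΩ : IsOpen Ω)
    (f : WeakComparison.E n → ℝ → ℝ)
    (hfpos : ∀ x ∈ Ω, ∀ s : ℝ, 0 < f x s)
    (hfLip : WeakComparison.LocallyLipschitzRHS Ω f)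
    (hfmono : ∀ x ∈ Ω, Antitone (f x))
    -- `u`, `v` are the continuous representatives, `Du`, `Dv` any representatives of the gradients
    (u v : WeakComparison.E n → ℝ) (Du Dv : WeakComparison.E n → WeakComparison.E n)
    (hucont : ContinuousOn u Ω) (hvcont : ContinuousOn v Ω)
    (huW : WeakComparison.MemW1Loc ⊤ Ω u Du) (hvW : WeakComparison.MemW1Loc ⊤ Ω v Dv)
    (hu : WeakComparison.IsLocalWeakSolution p f Ω u Du)
    (hv : WeakComparison.IsLocalWeakSolution p f Ω v Dv) :
    (∀ Ω' : Set (WeakComparison.E n), IsOpen Ω' → WeakComparison.CompactlyContained Ω' Ω →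
      (∀ x ∈ frontier Ω', u x ≤ v x) → ∀ x ∈ Ω', u x ≤ v x) ∧
    (WeakComparison.CompactlyContained {x | x ∈ Ω ∧ ‖Du x‖ ≤ 1} Ω →
      WeakComparison.LeOnBoundary Ω u v → ∀ x ∈ Ω, u x ≤ v x) := by
  have hn0 : 0 < n := by linarith
  refine ⟨fun Ω' hΩ' hΩ'Ω hle x hx => le_of_forall_pos_le_add fun ε hε => ?_,
    fun _ hle x hx => le_of_forall_pos_le_add fun ε hε => ?_⟩
  · exact WeakComparison.le_add_of_isCompact hn0 hp hΩ hfpos hfLip hfmono hucont hvcont huW hvW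
      hu hv hΩ' (subset_closure.trans hΩ'Ω.2) hε
      (WeakComparison.isCompact_superlevel_of_le_frontier hΩ'Ω hΩ' hucont hvcont hle hε) hx
  · exact WeakComparison.le_add_of_isCompact hn0 hp hΩ hfpos hfLip hfmono hucont hvcont huW hvW
      hu hv hΩ subset_rfl hε (hle.isCompact_superlevel hΩ hucont hvcont hε) hx
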